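/- Let $\mathbb K$ be a field, $n\ge 3$, and let $d$ and $\alpha=(\alpha_1,\dots,\alpha_n)$ be integers with $1\le\alpha_1\le\cdots\le\alpha_n\le d<\alpha_1+\cdots+\alpha_n$. Let $V=\{c\in\mathbb N^n:\ c_1+\cdots+c_n=d,\ c_i\le\alpha_i \text{ for all } i\}$, and let $J$ be the kernel of $\mathbb K[T_c:c\in V]\to\mathbb K[x_1,\dots,x_n]$, $T_c\mapsto x^c$. For $a,b\in V$ write $x^ax^b=x_{i_1}x_{i_2}\cdots x_{i_{2d}}$ with $i_1\le\cdots\le i_{2d}$, and let $\operatorname{sort}(a,b)=(a',b')$, where $x^{a'}=x_{i_1}x_{i_3}\cdots x_{i_{2d-1}}$ and $x^{b'}=x_{i_2}x_{i_4}\cdots x_{i_{2d}}$; the pair $(a,b)$ is sorted if $\operatorname{sort}(a,b)=(a,b)$. Write $a>_{\rm lex}b$ if the leftmost nonzero entry of $a-b$ is positive. The sorting graph $\mathcal G=\mathcal G(d,\alpha)$ has vertex set $V$ and the edges $\{a,b\}$ with $a>_{\rm lex}b$ and $(a,b)$ sorted. Let $\operatorname{MC}(\mathcal G)$ be its set of maximal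 cliques; a maximal clique has $n$ elements and is written $A=(a^1,\dots,a^n)$ with $a^1>_{\rm lex}\cdots>_{\rm lex}a^n$. Let $\operatorname{in}(J)$ be the initial ideal of $J$ with respect to a term order for which $T_aT_b$ is the leading term of $T_aT_b-T_{a'}T_{b'}$ whenever $\operatorname{sort}(a,b)=(a',b')$ and this binomial is nonzero. Such term orders exist. The ideal $\operatorname{in}(J)$ is a squarefree monomial ideal; let $\operatorname{in}(J)^\vee$ be its Alexander dual and $G(\operatorname{in}(J)^\vee)$ the minimal monomial generating set of the dual. Order on $\operatorname{MC}(\mathcal G)$. Let $\eta$ be the lexicographically smallest element of $V$, and put $\operatorname{rank}(a)=\sum_{j=1}^{n-1}(a_j-\eta_j)(n-j)$ and $\operatorname{rank}(A)=\operatorname{rank}(a^n)$. Two maximal cliques $A=(a^1,\dots,a^n)$ and $B=(b^1,\dots,b^n)$ are equivalent if $a^1=b^1$; equivalent cliques have the same rank. The signature $\operatorname{sgn}(A)=(s_1,\dots,s_{n-1})$ is the permutation of $\{1,\dots,n-1\}$ such that $a^{i+1}$ arises from $a^i$ by lowering coordinate $s_i$ by $1$ and raising coordinate $s_i+1$ by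 $1$. For an equivalence class $\mathcal E$ with first vertex $a^1$: if $a^1_1=1$, let $\kappa_1$ be the largest $\kappa\le n-1$ with $a^1_2=\cdots=a^1_\kappa=0$ ($\kappa_1=1$ if $a_2^1>0$), otherwise $\kappa_1=0$; if $a^1_n=\alpha_n-1$, let $\kappa_2$ be the smallest $\kappa\ge2$ with $a^1_j=\alpha_j$ for $\kappa\le j\le n-1$ ($\kappa_2=n$ if $a^1_{n-1}<\alpha_{n-1}$), otherwise $\kappa_2=n+1$. Choose in each class $\mathcal E$ a maximal clique $L=L(\mathcal E)$ with $$\operatorname{sgn}(L)=\begin{cases}(\tau_1,\dots,\tau_{\kappa_2-\kappa_1-2},\,n-1,n-2,\dots,\kappa_2-1,\,1,2,\dots,\kappa_1)&\text{if }\kappa_1<\kappa_2-1,\\(n-1,n-2,\dots,\kappa_2,\,1,2,\dots,\kappa_1)&\text{if }\kappa_1=\kappa_2-1,\end{cases}$$ for some $\tau_i$; such choices exist. If $\operatorname{sgn}(L)=\tau$ and $\operatorname{sgn}(A)=(k_1,\dots,k_{n-1})$ for some $A\in\mathcal E$, the relative signature is $\operatorname{sgn}_\tau(A)=(s_1,\dots,s_{n-1})$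 with $\tau_{s_i}=k_i$. Let $\prec$ be a total order on $\operatorname{MC}(\mathcal G)$ such that 1. if $\operatorname{rank}(B)<\operatorname{rank}(A)$, then $B\prec A$; 2. if $\operatorname{rank}(B)=\operatorname{rank}(A)$, $A$ and $B$ are not equivalent and $B\prec A$, then $B'\prec A'$ for all $A'$ equivalent to $A$ and all $B'$ equivalent to $B$; 3. if $A$ and $B$ lie in the same class $\mathcal E$ and $\tau=\operatorname{sgn}(L(\mathcal E))$, then $B\prec A$ if and only if the first nonzero entry of $\operatorname{sgn}_\tau(B)-\operatorname{sgn}_\tau(A)$ is negative. For every choice of the $L(\mathcal E)$ such total orders exist. Theorem. The map $A\mapsto T_{A^\complement}:=\prod_{v\in V\setminus A}T_v$ is a bijection from $\operatorname{MC}(\mathcal G)$ onto $G(\operatorname{in}(J)^\vee)$. For every choice of the $L(\mathcal E)$ and every total order $\prec$ as above, the order induced by $\prec$ on $G(\operatorname{in}(J)^\vee)$ is a linear quotient order: for each $A\in\operatorname{MC}(\mathcal G)$ the ideal $\langle T_{B^\complement}: B\prec A\rangle : T_{A^\complement}$ is generated by a set of variables of $\mathbb K[T_c:c\in V]$. -/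

import Mathlib

open Finset

namespace VeroneseSorting

/-! ### Monomial ideals -/

section MonomialIdeals

variable {σ K : Type*}

/-- The exponent of the squarefree monomial `∏ v ∈ F, X v`. -/
noncomputable def sqfreeExp (F : Finset σ) : σ →₀ ℕ := ∑ v ∈ F, Finsupp.single v 1

/-- The initial ideal of `I` with respect to a monomial order. -/
noncomputable def initialIdeal [CommRing K] (ord : MonomialOrder σ) (I : Ideal (MvPolynomial σ K)) :
    Ideal (MvPolynomial σ K) :=
  Ideal.span (ord.leadingTerm '' (I : Set (MvPolynomial σ K)))

/-- The Stanley–Reisner complex of a squarefree monomial ideal: the faces are the sets of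
variables whose product is not in the ideal. -/
def stanleyReisnerComplex [CommRing K] (I : Ideal (MvPolynomial σ K)) : Set (Finset σ) :=
  {F | MvPolynomial.monomial (sqfreeExp F) (1 : K) ∉ I}

/-- The Alexander dual of a simplicial complex: the complements of the nonfaces. -/
def dualComplex [Fintype σ] [DecidableEq σ] (Δ : Set (Finset σ)) : Set (Finset σ) :=
  {F | Fᶜ ∉ Δ}

/-- The Stanley–Reisner ideal of a simplicial complex, generated by its nonfaces. -/
noncomputable def stanleyReisnerIdeal (K : Type*) [CommRing K] (Δ : Set (Finset σ)) :
    Ideal (MvPolynomial σ K) :=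
  Ideal.span ((fun F : Finset σ => MvPolynomial.monomial (sqfreeExp F) (1 : K)) '' Δᶜ)

/-- The Alexander dual `I^∨` of a squarefree monomial ideal. -/
noncomputable def alexanderDual [CommRing K] [Fintype σ] [DecidableEq σ]
    (I : Ideal (MvPolynomial σ K)) : Ideal (MvPolynomial σ K) :=
  stanleyReisnerIdeal K (dualComplex (stanleyReisnerComplex I))

/-- (The exponents of) the minimal monomial generating set `G(I)` of a monomial ideal: the
monomials of `I` that are minimal with respect to divisibility. -/
def minGens [CommRing K] (I : Ideal (MvPolynomial σ K)) : Set (σ →₀ ℕ) :=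
  {u | Minimal (fun e => MvPolynomial.monomial e (1 : K) ∈ I) u}

/-- The relation `r` (`r v u` meaning that `v` comes before `u`) is a total order on the minimal
monomial generating set `G(I)`, and for each `u ∈ G(I)` the ideal `⟨v ∈ G(I) : v before u⟩ : u` is
generated by variables. -/
def IsLinearQuotientOrder [CommRing K] (I : Ideal (MvPolynomial σ K))
    (r : (σ →₀ ℕ) → (σ →₀ ℕ) → Prop) : Prop :=
  IsStrictTotalOrder (minGens I) (fun v u => r v u) ∧
  ∀ u ∈ minGens I, ∃ W : Set σ,
    (Ideal.span ((fun v => MvPolynomial.monomial v (1 : K)) '' {v | v ∈ minGens I ∧ r v u})).colon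
        {MvPolynomial.monomial u (1 : K)} =
      Ideal.span (MvPolynomial.X '' W)

end MonomialIdeals

/-! ### The Veronese type algebra and the sorting graph -/

/-- The set `V_{n,d}^α` of the tuples `c ∈ ℕ^n` with `|c| = d` and `c ≤ α`. -/
abbrev Vertex {n : ℕ} (d : ℕ) (α : Fin n → ℕ) : Type :=
  {c : Fin n → ℕ // ∑ i, c i = d ∧ ∀ i, c i ≤ α i}

instance {n : ℕ} (d : ℕ) (α : Fin n → ℕ) : Finite (Vertex d α) :=
  Set.Finite.to_subtype
    ((Set.finite_Iic α).subset fun _ hc => hc.2)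

noncomputable instance {n : ℕ} (d : ℕ) (α : Fin n → ℕ) : Fintype (Vertex d α) :=
  Fintype.ofFinite _

/-- `a >_lex b`: the leftmost nonzero entry of `a - b` is positive. -/
def LexGT {n : ℕ} (a b : Fin n → ℕ) : Prop := toLex b < toLex a

/-- The sorting operator on pairs. In the sorted word `x_{i_0} x_{i_1} ⋯` (with
`i_0 ≤ i_1 ≤ ⋯`) of the monomial `x^a x^b`, the letter `x_i` occupies the positions `t` with
`∑_{j < i} (a_j + b_j) ≤ t < ∑_{j ≤ i} (a_j + b_j)`. The letters at the positions `0, 2, 4, …` form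
the first monomial, those at the positions `1, 3, 5, …` the second. -/
def sortPair {n : ℕ} (a b : Fin n → ℕ) : (Fin n → ℕ) × (Fin n → ℕ) :=
  let positions : Fin n → Finset ℕ := fun i =>
    Finset.Ico (∑ j ∈ Finset.Iio i, (a j + b j)) (∑ j ∈ Finset.Iic i, (a j + b j))
  (fun i => #{t ∈ positions i | t % 2 = 0}, fun i => #{t ∈ positions i | t % 2 = 1})

/-- The pair `(a, b)` is sorted. -/
def IsSorted {n : ℕ} (a b : Fin n → ℕ) : Prop := sortPair a b = (a, b)

/-- The presentation ideal `J` of the algebra `𝕂[x^c : c ∈ V_{n,d}^α]`: the kernel of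
`𝕂[T] → 𝕂[x_1, …, x_n]`, `T_c ↦ x^c`. -/
noncomputable def presentationIdeal (K : Type*) [Field K] {n : ℕ} (d : ℕ) (α : Fin n → ℕ) :
    Ideal (MvPolynomial (Vertex d α) K) :=
  RingHom.ker (MvPolynomial.aeval (R := K)
    (fun c : Vertex d α => ∏ i, (MvPolynomial.X i : MvPolynomial (Fin n) K) ^ c.1 i))

/-- A term order on `𝕂[T]` for which `T_a T_b` is the leading term of `T_a T_b - T_{a'} T_{b'}`
whenever `sort(a, b) = (a', b')` and this binomial is not zero. -/
def IsSortingTermOrder {n d : ℕ} {α : Fin n → ℕ} (ord : MonomialOrder (Vertex d α)) : Prop :=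
  ∀ a b a' b' : Vertex d α, sortPair a.1 b.1 = (a'.1, b'.1) →
    Finsupp.single a 1 + Finsupp.single b 1 ≠
      (Finsupp.single a' 1 + Finsupp.single b' 1 : Vertex d α →₀ ℕ) →
    ord.toSyn (Finsupp.single a' 1 + Finsupp.single b' 1) <
      ord.toSyn (Finsupp.single a 1 + Finsupp.single b 1)

/-- The sorting graph `𝒢(d, α)`. -/
def sortingGraph {n : ℕ} (d : ℕ) (α : Fin n → ℕ) : SimpleGraph (Vertex d α) where
  Adj a b := (LexGT a.1 b.1 ∧ IsSorted a.1 b.1) ∨ (LexGT b.1 a.1 ∧ IsSorted b.1 a.1)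
  symm := ⟨fun _ _ h => h.symm⟩
  loopless := ⟨fun _ h => h.elim (fun h => lt_irrefl _ h.1) (fun h => lt_irrefl _ h.1)⟩

/-- The set `MC(𝒢(d, α))` of the maximal cliques, as a type. -/
abbrev MaxClique {n : ℕ} (d : ℕ) (α : Fin n → ℕ) : Type :=
  {A : Finset (Vertex d α) //
    Maximal (fun C : Finset (Vertex d α) => (sortingGraph d α).IsClique (C : Set (Vertex d α))) A}

/-- The exponent of the monomial `T_{A^∁} = ∏_{v ∉ A} T_v`. -/
noncomputable def complExp {n d : ℕ} {α : Fin n → ℕ} (A : MaxClique d α) : Vertex d α →₀ ℕ :=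
  sqfreeExp (A.1)ᶜ

/-- The relation on monomials induced by a relation on maximal cliques via `A ↦ T_{A^∁}`. -/
def inducedRel {n d : ℕ} {α : Fin n → ℕ} (prec : MaxClique d α → MaxClique d α → Prop)
    (v u : Vertex d α →₀ ℕ) : Prop :=
  ∃ B A : MaxClique d α, complExp B = v ∧ complExp A = u ∧ prec B A

/-! ### The order on maximal cliques

From here on `n = m + 1`. Coordinates are indexed by `Fin (m + 1)`, jumps by `Fin m`: the index
`i : Fin m` stands for the number `i + 1 ∈ {1, …, n - 1}`. -/

section Order

variable {m d : ℕ} {α : Fin (m + 1) → ℕ}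

/-- `η` is the smallest element of `V_{n,d}^α` with respect to `>_lex`. -/
def IsLexSmallest (η : Vertex d α) : Prop := ∀ a : Vertex d α, toLex η.1 ≤ toLex a.1

/-- `A = (a^1, …, a^n)` with `a^1 >_lex ⋯ >_lex a^n`. -/
def IsTupleForm (A : MaxClique d α) (a : Fin (m + 1) → Vertex d α) : Prop :=
  (∀ i j, i < j → LexGT (a i).1 (a j).1) ∧ Set.range a = (A.1 : Set (Vertex d α))

/-- Two maximal cliques are equivalent if they have the same first vertex. -/
def Equivalent (A B : MaxClique d α) : Prop :=
  ∃ a b, IsTupleForm A a ∧ IsTupleForm B b ∧ a 0 = b 0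

/-- The rank `∑_{j=1}^{n-1} (a_j - η_j)(n - j)` of a tuple. -/
def tupleRank (η a : Fin (m + 1) → ℕ) : ℤ :=
  ∑ j : Fin m, ((a j.castSucc : ℤ) - η j.castSucc) * ((m : ℤ) - j)

/-- `r` is the rank of (the equivalence class of) `A`, that is, the rank of its last vertex. -/
def HasRank (η : Vertex d α) (A : MaxClique d α) (r : ℤ) : Prop :=
  ∃ a, IsTupleForm A a ∧ tupleRank η.1 (a (Fin.last m)).1 = r

/-- `Δ(a, b) = [s, s + 1)`: the tuple `b` arises from `a` by an `s`-jump. -/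
def IsJump (s : Fin m) (a b : Fin (m + 1) → ℕ) : Prop :=
  b s.castSucc + 1 = a s.castSucc ∧ b s.succ = a s.succ + 1 ∧
    ∀ i, i ≠ s.castSucc → i ≠ s.succ → b i = a i

/-- The permutation `s` is the signature of `A`: `Δ(a^i, a^{i+1}) = [s_i, s_i + 1)` for all `i`. -/
def HasSignature (A : MaxClique d α) (s : Equiv.Perm (Fin m)) : Prop :=
  ∃ a, IsTupleForm A a ∧ ∀ i : Fin m, IsJump (s i) (a i.castSucc).1 (a i.succ).1

/-- The number `κ₁` for the first vertex `a`: if `a_1 = 1`, the largest `κ ≤ n - 1` with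
`a_2 = ⋯ = a_κ = 0` (so `1` if `a_2 > 0`); otherwise `0`. -/
def kappa₁ (a : Fin (m + 1) → ℕ) : ℕ :=
  if a 0 = 1 then
    Nat.findGreatest (fun k => ∀ j : Fin (m + 1), 2 ≤ (j : ℕ) + 1 → (j : ℕ) + 1 ≤ k → a j = 0) m
  else 0

/-- The number `κ₂` for the first vertex `a`: if `a_n = α_n - 1`, the smallest `κ ≥ 2` with
`a_j = α_j` for `κ ≤ j ≤ n - 1` (so `n` if `a_{n-1} < α_{n-1}`); otherwise `n + 1`. -/
noncomputable def kappa₂ (α a : Fin (m + 1) → ℕ) : ℕ :=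
  if a (Fin.last m) + 1 = α (Fin.last m) then
    sInf {k | 2 ≤ k ∧ ∀ j : Fin (m + 1), k ≤ (j : ℕ) + 1 → (j : ℕ) + 1 ≤ m → a j = α j}
  else m + 2

/-- The one-line notation of a permutation of `{1, …, n - 1}`. -/
def oneLine (s : Equiv.Perm (Fin m)) : List ℕ := List.ofFn fun i => (s i : ℕ) + 1

/-- With `κ₁`, `κ₂` belonging to the first vertex `a`, the permutation `s` has the form
`(τ_1, …, n-1, n-2, …, κ₂-1, 1, 2, …, κ₁)` with arbitrary `τ_i` if `κ₁ < κ₂ - 1`, and is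
`(n-1, n-2, …, κ₂, 1, 2, …, κ₁)` if `κ₁ = κ₂ - 1`. -/
def IsSpecialSignature (α a : Fin (m + 1) → ℕ) (s : Equiv.Perm (Fin m)) : Prop :=
  (kappa₁ a + 1 < kappa₂ α a ∧ ∃ τ : List ℕ, oneLine s =
    τ ++ (List.range' (kappa₂ α a - 1) (m + 2 - kappa₂ α a)).reverse ++
      List.range' 1 (kappa₁ a)) ∨
  (kappa₁ a + 1 = kappa₂ α a ∧ oneLine s =
    (List.range' (kappa₂ α a) (m + 1 - kappa₂ α a)).reverse ++ List.range' 1 (kappa₁ a))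

/-- `L` chooses in each equivalence class (given by any of its members `A`) a maximal clique `L A`
whose signature has the special form. -/
def IsMarking (L : MaxClique d α → MaxClique d α) : Prop :=
  (∀ A, Equivalent A (L A)) ∧ (∀ A B, Equivalent A B → L A = L B) ∧
  ∀ A, ∃ a s, IsTupleForm A a ∧ HasSignature (L A) s ∧ IsSpecialSignature α (a 0).1 s

/-- The relative signature of a maximal clique of signature `k` with respect to `τ`: the `i`-th
entry is the index `s` with `τ_s = k_i`. -/
def relSignature (τ k : Equiv.Perm (Fin m)) : Fin m → Fin m := fun i => τ.symm (k i)

/-- The rules that the total order `prec` (`prec B A` is `B ≺ A`) on the maximal cliques obeys. -/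
structure IsRuledOrder (η : Vertex d α) (L : MaxClique d α → MaxClique d α)
    (prec : MaxClique d α → MaxClique d α → Prop) : Prop where
  isStrictTotalOrder : IsStrictTotalOrder (MaxClique d α) prec
  of_rank_lt : ∀ A B rA rB, HasRank η A rA → HasRank η B rB → rB < rA → prec B A
  of_classes : ∀ A B r, HasRank η A r → HasRank η B r → ¬ Equivalent A B → prec B A →
    ∀ A' B', Equivalent A A' → Equivalent B B' → prec B' A'
  within_class : ∀ A B kA kB τ, Equivalent A B → HasSignature A kA → HasSignature B kB →
    HasSignature (L A) τ →
    (prec B A ↔ toLex (relSignature τ kB) < toLex (relSignature τ kA))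

end Order

end VeroneseSorting

open VeroneseSorting

universe u w

/-! Everything is read off from prefix sums. Sorting a pair replaces its two prefix sums of each
length by the halves of their total, rounded up and down. So a pair is sorted iff the prefix sums of
the first tuple exceed those of the second by 0 or 1 (`isSorted_iff_above`). A maximal clique is a
chain of `n` vertices in which each proper prefix sum is lowered by one exactly once
(`MaxClique.exists_chain`). Up to a constant, its rank is the sum of the proper prefix sums of its
first vertex.

Incomparable pairs give quadratic leading monomials. Conversely, sorting an incomparable pair inside
a monomial keeps its image and lowers it in the term order, and a fibre contains at most one
monomial supported on a clique (`eq_of_expo_eq`), so such a monomial is the smallest in its fibre.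
Hence the Stanley–Reisner complex of the initial ideal is the clique complex
(`stanleyReisnerComplex_initialIdeal`), and linear quotients of the dual follow from a shelling: for
`B ≺ A` there are `C ≺ A` and `v ∈ A \ B` with `A \ {v} ⊆ C` (`IsRuledOrder.exists_flip`,
`isLinearQuotientOrder_of_shelling`).

Two moves produce `C`. A swap interchanges consecutive jumps of `A` that stand in the opposite order
in the marked signature `τ`; this is possible because `τ` itself can be carried out from the same
first vertex, and it lowers the relative signature. A rotation drops the first vertex and repeats
the first jump at the end, which lowers the rank.

If `A` and `B` are equivalent, a swap at a suitable descent works. If not, the first vertex of `A`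
is not in `B`, and a rotation works unless the first jump of `A` is tight. At a tight place no first
vertex of a maximal clique has a smaller prefix sum. The special form of `τ` puts the tight places
last, so all jumps of `A` up to its first descent relative to `τ` are tight. The vertex removed by
the swap at that descent cannot be in `B`: otherwise the first vertex of `B` would dominate that of
`A` in every prefix sum, and since its rank is not larger the two would coincide. Without any
descent the same contradiction arises at once. -/

namespace VeroneseSorting

/-! ### Weight orders -/

/-- The monomial order that compares weights first and breaks ties lexicographically. -/
noncomputable def weightOrder {σ : Type} [LinearOrder σ] [WellFoundedGT σ]
    (w : (σ →₀ ℕ) →+ ℕ) : MonomialOrder.{0, 0} σ :=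
  let f : (σ →₀ ℕ) →+ Lex (ℕ × Lex (σ →₀ ℕ)) :=
    { toFun := fun e => toLex (w e, toLex e)
      map_zero' := by rw [map_zero]; rfl
      map_add' := fun a b => by rw [map_add]; rfl }
  have hf : Function.Injective f := fun a b h => by
    have h' := congrArg (fun z => ofLex (ofLex z).2) h
    exact h'
  -- The type of synonyms must be additively isomorphic to the exponents. As `f` is only injective,
  -- its image is taken instead of the whole product.
  { syn := AddMonoidHom.mrange f
    toSyn :=
      { Equiv.ofBijective (fun a => (⟨f a, a, rfl⟩ : AddMonoidHom.mrange f))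
          ⟨fun a b h => hf (congrArg Subtype.val h), fun ⟨_, a, ha⟩ => ⟨a, Subtype.ext ha⟩⟩ with
        map_add' := fun a b => by
          apply Subtype.ext
          change f (a + b) = f a + f b
          exact f.map_add a b }
    toSyn_monotone := fun a b h => by
      obtain ⟨c, rfl⟩ := exists_add_of_le h
      change f a ≤ f (a + c)
      have h0 : (0 : Lex (ℕ × Lex (σ →₀ ℕ))) ≤ f c := by
        rw [Prod.Lex.le_iff]
        rcases Nat.eq_zero_or_pos (w c) with hw | hw
        · exact Or.inr ⟨hw.symm, bot_le (a := toLex c)⟩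
        · exact Or.inl hw
      rw [map_add]
      exact le_add_of_nonneg_right h0
    wellFoundedLT_syn := inferInstance }

theorem weightOrder_lt_of_weight_lt {σ : Type} [LinearOrder σ] [WellFoundedGT σ]
    (w : (σ →₀ ℕ) →+ ℕ) {a b : σ →₀ ℕ} (h : w a < w b) :
    (weightOrder w).toSyn a < (weightOrder w).toSyn b := by
  change toLex (w a, toLex a) < toLex (w b, toLex b)
  rw [Prod.Lex.lt_iff]
  exact Or.inl h

/-! ### Prefix sums -/

section PrefixSums

variable {m : ℕ}

/-- The sum of the first `k` entries of `a`. -/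
def pre (a : Fin (m + 1) → ℕ) (k : ℕ) : ℕ := ∑ j : Fin (m + 1), if (j : ℕ) < k then a j else 0

@[simp] theorem pre_zero (a : Fin (m + 1) → ℕ) : pre a 0 = 0 := by simp [pre]

theorem pre_succ (a : Fin (m + 1) → ℕ) (k : Fin (m + 1)) : pre a (k + 1) = pre a k + a k := by
  have : ∀ j : Fin (m + 1), (if (j : ℕ) < k + 1 then a j else 0) =
      (if (j : ℕ) < k then a j else 0) + if j = k then a j else 0 := by
    intro j
    have := @Fin.ext_iff _ j k
    split_ifs <;> first | rfl | omega
  simp only [pre, this, sum_add_distrib, sum_ite_eq', mem_univ, if_true]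

theorem pre_of_le (a : Fin (m + 1) → ℕ) {k : ℕ} (hk : m + 1 ≤ k) : pre a k = ∑ i, a i := by
  refine sum_congr rfl fun j _ => if_pos (by omega)

theorem pre_mono (a : Fin (m + 1) → ℕ) : Monotone (pre a) := by
  intro k l hkl
  refine sum_le_sum fun j _ => ?_
  split_ifs <;> omega

theorem pre_eq_sum_Iio (a : Fin (m + 1) → ℕ) (k : Fin (m + 1)) :
    pre a k = ∑ j ∈ Iio k, a j := by
  rw [pre, ← sum_filter]
  congr 1
  ext j
  rw [mem_filter, mem_Iio, Fin.lt_def]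
  simp

theorem pre_succ_eq_sum_Iic (a : Fin (m + 1) → ℕ) (k : Fin (m + 1)) :
    pre a (k + 1) = ∑ j ∈ Iic k, a j := by
  rw [pre, ← sum_filter]
  congr 1
  ext j
  rw [mem_filter, mem_Iic, Fin.le_def, Nat.lt_succ_iff]
  simp

theorem pre_add (a b : Fin (m + 1) → ℕ) (k : ℕ) : pre (a + b) k = pre a k + pre b k := by
  simp only [pre, ← sum_add_distrib]
  refine sum_congr rfl fun j _ => ?_
  split_ifs <;> simp

theorem eq_of_pre_eq {a b : Fin (m + 1) → ℕ} (h : ∀ k ≤ m + 1, pre a k = pre b k) : a = b := by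
  funext k
  have h1 := pre_succ a k
  have h2 := pre_succ b k
  have h3 := h k (by omega)
  have h4 := h (k + 1) (by omega)
  omega

/-! ### Sorting in terms of prefix sums -/

theorem card_even_Ico {p q : ℕ} (h : p ≤ q) :
    #{t ∈ Ico p q | t % 2 = 0} = (q + 1) / 2 - (p + 1) / 2 := by
  induction q, h using Nat.le_induction with
  | base => simp
  | succ q hpq ih =>
    rw [← insert_Ico_right_eq_Ico_add_one hpq, filter_insert]
    split_ifs with hq
    · rw [card_insert_of_notMem (by simp), ih]
      omega
    · rw [ih]
      omega

theorem card_odd_Ico {p q : ℕ} (h : p ≤ q) :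
    #{t ∈ Ico p q | t % 2 = 1} = q / 2 - p / 2 := by
  induction q, h using Nat.le_induction with
  | base => simp
  | succ q hpq ih =>
    rw [← insert_Ico_right_eq_Ico_add_one hpq, filter_insert]
    split_ifs with hq
    · rw [card_insert_of_notMem (by simp), ih]
      omega
    · rw [ih]
      omega

theorem sortPair_fst_apply (a b : Fin (m + 1) → ℕ) (k : Fin (m + 1)) :
    (sortPair a b).1 k =
      (pre a (k + 1) + pre b (k + 1) + 1) / 2 - (pre a k + pre b k + 1) / 2 := by
  simp only [sortPair, sum_add_distrib, ← pre_eq_sum_Iio, ← pre_succ_eq_sum_Iic]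
  exact card_even_Ico (add_le_add (pre_mono a (by omega)) (pre_mono b (by omega)))

theorem sortPair_snd_apply (a b : Fin (m + 1) → ℕ) (k : Fin (m + 1)) :
    (sortPair a b).2 k = (pre a (k + 1) + pre b (k + 1)) / 2 - (pre a k + pre b k) / 2 := by
  simp only [sortPair, sum_add_distrib, ← pre_eq_sum_Iio, ← pre_succ_eq_sum_Iic]
  exact card_odd_Ico (add_le_add (pre_mono a (by omega)) (pre_mono b (by omega)))

/-- The counts of even positions telescope: among the first `N` positions, numbered from 0, exactly
`(N + 1) / 2` are even. The second component gets the remaining `N / 2`. -/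
theorem pre_sortPair_fst (a b : Fin (m + 1) → ℕ) (k : ℕ) :
    pre (sortPair a b).1 k = (pre a k + pre b k + 1) / 2 := by
  have key : ∀ k ≤ m + 1, pre (sortPair a b).1 k = (pre a k + pre b k + 1) / 2 := by
    intro k hk
    induction k with
    | zero => simp
    | succ k ih =>
      have h1 := pre_succ (sortPair a b).1 ⟨k, hk⟩
      rw [sortPair_fst_apply] at h1
      have h2 := pre_mono a (Nat.le_succ k)
      have h3 := pre_mono b (Nat.le_succ k)
      simp only [Nat.succ_eq_add_one] at *
      rw [h1, ih (by omega)]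
      omega
  rcases le_total k (m + 1) with hk | hk
  · exact key k hk
  · rw [pre_of_le _ hk, pre_of_le a hk, pre_of_le b hk, ← pre_of_le _ le_rfl, key _ le_rfl,
      pre_of_le _ le_rfl, pre_of_le _ le_rfl]

theorem pre_sortPair_snd (a b : Fin (m + 1) → ℕ) (k : ℕ) :
    pre (sortPair a b).2 k = (pre a k + pre b k) / 2 := by
  have key : ∀ k ≤ m + 1, pre (sortPair a b).2 k = (pre a k + pre b k) / 2 := by
    intro k hk
    induction k with
    | zero => simp
    | succ k ih =>
      have h1 := pre_succ (sortPair a b).2 ⟨k, hk⟩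
      rw [sortPair_snd_apply] at h1
      have h2 := pre_mono a (Nat.le_succ k)
      have h3 := pre_mono b (Nat.le_succ k)
      simp only [Nat.succ_eq_add_one] at *
      rw [h1, ih (by omega)]
      omega
  rcases le_total k (m + 1) with hk | hk
  · exact key k hk
  · rw [pre_of_le _ hk, pre_of_le a hk, pre_of_le b hk, ← pre_of_le _ le_rfl, key _ le_rfl,
      pre_of_le _ le_rfl, pre_of_le _ le_rfl]

/-- Every prefix sum of `a` exceeds the one of `b` by `0` or `1`. -/
def Above (a b : Fin (m + 1) → ℕ) : Prop := ∀ k, pre b k ≤ pre a k ∧ pre a k ≤ pre b k + 1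

theorem isSorted_iff_above {a b : Fin (m + 1) → ℕ} : IsSorted a b ↔ Above a b := by
  constructor
  · intro h k
    have h1 := pre_sortPair_fst a b k
    have h2 := pre_sortPair_snd a b k
    rw [IsSorted] at h
    rw [h] at h1 h2
    simp only at h1 h2
    omega
  · intro h
    refine Prod.ext (eq_of_pre_eq fun k _ => ?_) (eq_of_pre_eq fun k _ => ?_)
    · rw [pre_sortPair_fst]
      have := h k
      simp only
      omega
    · rw [pre_sortPair_snd]
      have := h k
      simp only
      omega

theorem LexGT.exists_pre_lt {a b : Fin (m + 1) → ℕ} (h : LexGT a b) :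
    ∃ k, pre b k < pre a k := by
  obtain ⟨i, hi, hlt⟩ := h
  refine ⟨i + 1, ?_⟩
  have h1 := pre_succ a i
  have h2 := pre_succ b i
  have h3 : pre b i = pre a i := by
    rw [pre_eq_sum_Iio, pre_eq_sum_Iio]
    exact sum_congr rfl fun j hj => hi j (mem_Iio.1 hj)
  have h4 : b i < a i := hlt
  omega

theorem lexGT_of_pre_le {a b : Fin (m + 1) → ℕ} (h : ∀ k, pre b k ≤ pre a k) (hab : a ≠ b) :
    LexGT a b := by
  by_contra hn
  have h1 : toLex a < toLex b :=
    lt_of_le_of_ne (not_lt.1 hn) fun h => hab (toLex.injective h)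
  obtain ⟨k, hk⟩ := LexGT.exists_pre_lt (a := b) (b := a) h1
  exact absurd (h k) (not_le.2 hk)

theorem Above.lexGT {a b : Fin (m + 1) → ℕ} (h : Above a b) (hab : a ≠ b) : LexGT a b :=
  lexGT_of_pre_le (fun k => (h k).1) hab

theorem Above.refl (a : Fin (m + 1) → ℕ) : Above a a := fun _ => ⟨le_rfl, Nat.le_succ _⟩

variable {d : ℕ} {α : Fin (m + 1) → ℕ}

theorem sortingGraph_adj_iff {a b : Vertex d α} :
    (sortingGraph d α).Adj a b ↔ a ≠ b ∧ (Above a.1 b.1 ∨ Above b.1 a.1) := by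
  simp only [sortingGraph, isSorted_iff_above]
  constructor
  · rintro (⟨h1, h2⟩ | ⟨h1, h2⟩)
    · exact ⟨fun h => by subst h; exact lt_irrefl _ h1, Or.inl h2⟩
    · exact ⟨fun h => by subst h; exact lt_irrefl _ h1, Or.inr h2⟩
  · rintro ⟨hne, h | h⟩
    · exact Or.inl ⟨h.lexGT fun h => hne (Subtype.ext h), h⟩
    · exact Or.inr ⟨h.lexGT fun h => hne (Subtype.ext h.symm), h⟩

theorem Vertex.pre_of_le (a : Vertex d α) {k : ℕ} (hk : m + 1 ≤ k) : pre a.1 k = d :=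
  (VeroneseSorting.pre_of_le a.1 hk).trans a.2.1

theorem Vertex.pre_le (a : Vertex d α) (k : ℕ) : pre a.1 k ≤ d := by
  rcases le_total k (m + 1) with hk | hk
  · exact (pre_mono _ hk).trans (a.pre_of_le le_rfl).le
  · exact (a.pre_of_le hk).le

theorem Vertex.pre_succ_le (a : Vertex d α) (k : Fin (m + 1)) :
    pre a.1 (k + 1) ≤ pre a.1 k + α k := by
  rw [pre_succ]
  exact Nat.add_le_add_left (a.2.2 k) _

theorem Vertex.eq_of_pre_eq {a b : Vertex d α} (h : ∀ k < m, pre a.1 (k + 1) = pre b.1 (k + 1)) :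
    a = b := by
  refine Subtype.ext (VeroneseSorting.eq_of_pre_eq fun k hk => ?_)
  rcases k with _ | k
  · simp
  · rcases Nat.lt_or_ge k m with hk' | hk'
    · exact h k hk'
    · rw [a.pre_of_le (by omega), b.pre_of_le (by omega)]

/-- The vertex with given prefix sums. -/
theorem exists_vertex (x : ℕ → ℕ) (h0 : x 0 = 0) (hd : x (m + 1) = d)
    (h : ∀ k : Fin (m + 1), x k ≤ x (k + 1) ∧ x (k + 1) ≤ x k + α k) :
    ∃ a : Vertex d α, ∀ k ≤ m + 1, pre a.1 k = x k := by
  have key : ∀ k ≤ m + 1, pre (fun k : Fin (m + 1) => x (k + 1) - x k) k = x k := by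
    intro k hk
    induction k with
    | zero => simp [h0]
    | succ k ih =>
      have h1 := pre_succ (fun k : Fin (m + 1) => x (k + 1) - x k) ⟨k, hk⟩
      have h2 := h ⟨k, hk⟩
      simp only at h1 h2
      rw [h1, ih (by omega)]
      omega
  refine ⟨⟨fun k => x (k + 1) - x k, ?_, fun k => ?_⟩, key⟩
  · rw [← pre_of_le _ le_rfl, key _ le_rfl, hd]
  · have := h k
    simp only
    omega

end PrefixSums

/-! ### Jumps -/

section Jumps

variable {m d : ℕ} {α : Fin (m + 1) → ℕ}

/-- A unit moved one entry to the right changes a single prefix sum, the one that ends between the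
two entries. Jumps are handled in this form from here on. -/
theorem isJump_iff_pre {s : Fin m} {a b : Fin (m + 1) → ℕ} :
    IsJump s a b ↔ ∀ k, pre b k + (if k = s + 1 then 1 else 0) = pre a k := by
  constructor
  · rintro ⟨h1, h2, h3⟩
    have hs := s.2
    have key : ∀ k ≤ m + 1, pre b k + (if k = s + 1 then 1 else 0) = pre a k := by
      intro k hk
      induction k with
      | zero => simp
      | succ k ih =>
        have ha := pre_succ a ⟨k, hk⟩
        have hb := pre_succ b ⟨k, hk⟩
        have ih := ih (by omega)
        simp only at ha hb
        by_cases hk1 : (⟨k, hk⟩ : Fin (m + 1)) = s.castSucc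
        · have : k = s := congrArg Fin.val hk1
          rw [hk1] at ha hb
          split_ifs at ih ⊢ <;> omega
        by_cases hk2 : (⟨k, hk⟩ : Fin (m + 1)) = s.succ
        · have : k = s + 1 := congrArg Fin.val hk2
          rw [hk2] at ha hb
          split_ifs at ih ⊢ <;> omega
        have := h3 _ hk1 hk2
        have hk1' : k ≠ s := fun h => hk1 (Fin.ext h)
        have hk2' : k ≠ s + 1 := fun h => hk2 (Fin.ext h)
        split_ifs at ih ⊢ <;> omega
    intro k
    rcases le_total k (m + 1) with hk | hk
    · exact key k hk
    · have := key (m + 1) le_rfl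
      rw [pre_of_le _ hk, pre_of_le _ hk]
      rw [pre_of_le _ le_rfl, pre_of_le _ le_rfl] at this
      split_ifs at this ⊢ <;> omega
  · intro h
    have key : ∀ k : Fin (m + 1), b k + (if (k : ℕ) = s then 1 else 0) =
        a k + (if (k : ℕ) = s + 1 then 1 else 0) := by
      intro k
      have h1 := h k
      have h2 := h (k + 1)
      rw [pre_succ, pre_succ] at h2
      split_ifs at h1 h2 ⊢ <;> omega
    refine ⟨by simpa using key s.castSucc, by simpa using key s.succ, fun i h1 h2 => ?_⟩
    have h1' : (i : ℕ) ≠ s := fun h => h1 (Fin.ext h)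
    have h2' : (i : ℕ) ≠ s + 1 := fun h => h2 (Fin.ext h)
    simpa [h1', h2'] using key i

theorem exists_isJump {s : Fin m} (a : Vertex d α) (h1 : 0 < a.1 s.castSucc)
    (h2 : a.1 s.succ < α s.succ) : ∃ b : Vertex d α, IsJump s a.1 b.1 := by
  have hs := s.2
  have e1 := pre_succ a.1 s.castSucc
  have e2 := pre_succ a.1 s.succ
  simp only [Fin.val_castSucc, Fin.val_succ] at e1 e2
  obtain ⟨b, hb⟩ := exists_vertex (d := d) (α := α)
    (fun k => pre a.1 k - if k = s + 1 then 1 else 0) (by simp)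
    (by rw [if_neg (by omega), a.pre_of_le le_rfl]; omega) (fun k => by
      have h3 := pre_succ a.1 k
      have h4 := a.2.2 k
      by_cases hk1 : k = s.castSucc
      · subst hk1
        simp only [Fin.val_castSucc] at *
        split_ifs <;> omega
      by_cases hk2 : k = s.succ
      · subst hk2
        simp only [Fin.val_succ] at *
        split_ifs <;> omega
      have hk1' : (k : ℕ) ≠ s := fun h => hk1 (Fin.ext h)
      have hk2' : (k : ℕ) ≠ s + 1 := fun h => hk2 (Fin.ext h)
      split_ifs <;> omega)
  refine ⟨b, isJump_iff_pre.2 fun k => ?_⟩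
  rcases le_total k (m + 1) with hk | hk
  · rw [hb k hk]
    split_ifs with h
    · subst h; omega
    · omega
  · rw [a.pre_of_le hk, b.pre_of_le hk, if_neg (by omega)]
    rfl

theorem exists_isJump_to {s : Fin m} (a : Vertex d α) (h1 : a.1 s.castSucc < α s.castSucc)
    (h2 : 0 < a.1 s.succ) : ∃ b : Vertex d α, IsJump s b.1 a.1 := by
  have hs := s.2
  have e1 := pre_succ a.1 s.castSucc
  have e2 := pre_succ a.1 s.succ
  simp only [Fin.val_castSucc, Fin.val_succ] at e1 e2
  obtain ⟨b, hb⟩ := exists_vertex (d := d) (α := α)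
    (fun k => pre a.1 k + if k = s + 1 then 1 else 0) (by simp)
    (by rw [if_neg (by omega), a.pre_of_le le_rfl]; omega) (fun k => by
      have h3 := pre_succ a.1 k
      have h4 := a.2.2 k
      by_cases hk1 : k = s.castSucc
      · subst hk1
        simp only [Fin.val_castSucc] at *
        split_ifs <;> omega
      by_cases hk2 : k = s.succ
      · subst hk2
        simp only [Fin.val_succ] at *
        split_ifs <;> omega
      have hk1' : (k : ℕ) ≠ s := fun h => hk1 (Fin.ext h)
      have hk2' : (k : ℕ) ≠ s + 1 := fun h => hk2 (Fin.ext h)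
      split_ifs <;> omega)
  refine ⟨b, isJump_iff_pre.2 fun k => ?_⟩
  rcases le_total k (m + 1) with hk | hk
  · rw [hb k hk]
  · rw [a.pre_of_le hk, b.pre_of_le hk, if_neg (by omega)]
    rfl

/-- A vertex with a prefix sum larger than that of another vertex can be lowered at such a
place. -/
theorem exists_isJump_of_pre_lt (hα : ∀ i, 1 ≤ α i) {u v : Vertex d α} {k : ℕ}
    (hk : pre v.1 k < pre u.1 k) :
    ∃ s : Fin m, pre v.1 (s + 1) < pre u.1 (s + 1) ∧ ∃ w : Vertex d α, IsJump s u.1 w.1 := by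
  classical
  -- At the shortest prefix where `u` exceeds `v`, the excess has just appeared, so the last entry
  -- of that prefix of `u` is positive.
  have hex : ∃ s : Fin m, pre v.1 (s + 1) < pre u.1 (s + 1) ∧ 0 < u.1 s.castSucc := by
    have hk' : ∃ k, pre v.1 k < pre u.1 k := ⟨k, hk⟩
    have hmin := Nat.find_spec hk'
    set l := Nat.find hk' with hl
    rcases Nat.eq_zero_or_pos l with h0 | h0
    · simp [h0] at hmin
    have hlt : ¬ pre v.1 (l - 1) < pre u.1 (l - 1) := Nat.find_min hk' (by omega)
    have hlm : l < m + 1 := by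
      by_contra h
      rw [u.pre_of_le (by omega), v.pre_of_le (by omega)] at hmin
      exact lt_irrefl _ hmin
    have e : l - 1 + 1 = l := by omega
    refine ⟨⟨l - 1, by omega⟩, by simpa only [e] using hmin, ?_⟩
    have h1 := pre_succ u.1 (⟨l - 1, by omega⟩ : Fin m).castSucc
    simp only [Fin.val_castSucc, e] at h1
    have := pre_mono v.1 (Nat.sub_le l 1)
    omega
  -- For the largest such `s` the next entry of `u` has room. If the excess ends there, `u` grew by
  -- less than `v`, hence by less than the cap. If it persists, a full entry would be positive and
  -- `s + 1` would also qualify.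
  obtain ⟨s, ⟨hs, hpos⟩, hmax⟩ := (Set.toFinite
    {s : Fin m | pre v.1 (s + 1) < pre u.1 (s + 1) ∧ 0 < u.1 s.castSucc}).exists_maximal hex
  refine ⟨s, hs, exists_isJump u hpos ?_⟩
  have h1 := pre_succ u.1 s.succ
  have h2 := v.pre_succ_le s.succ
  simp only [Fin.val_succ] at h1 h2
  by_cases hlt : pre v.1 (s + 1 + 1) < pre u.1 (s + 1 + 1)
  · have hsm : (s : ℕ) + 1 < m := by
      by_contra h
      rw [u.pre_of_le (by omega), v.pre_of_le (by omega)] at hlt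
      exact lt_irrefl _ hlt
    by_contra hn
    have hle := hmax (y := ⟨s + 1, hsm⟩) ⟨hlt, ?_⟩ (Fin.le_def.2 (Nat.le_succ _))
    · exact absurd (Fin.le_def.1 hle) (by simp)
    · have e : (⟨s + 1, hsm⟩ : Fin m).castSucc = s.succ := rfl
      rw [e]
      have := hα s.succ
      omega
  · omega

/-- A vertex with a prefix sum smaller than that of another vertex can be raised at such a
place. -/
theorem exists_isJump_to_of_pre_lt (hα : ∀ i, 1 ≤ α i) {u v : Vertex d α} {k : ℕ}
    (hk : pre u.1 k < pre v.1 k) :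
    ∃ s : Fin m, pre u.1 (s + 1) < pre v.1 (s + 1) ∧ ∃ w : Vertex d α, IsJump s w.1 u.1 := by
  classical
  have hex : ∃ s : Fin m, pre u.1 (s + 1) < pre v.1 (s + 1) ∧ u.1 s.castSucc < α s.castSucc := by
    have hk' : ∃ k, pre u.1 k < pre v.1 k := ⟨k, hk⟩
    have hmin := Nat.find_spec hk'
    set l := Nat.find hk' with hl
    rcases Nat.eq_zero_or_pos l with h0 | h0
    · simp [h0] at hmin
    have hlt : ¬ pre u.1 (l - 1) < pre v.1 (l - 1) := Nat.find_min hk' (by omega)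
    have hlm : l < m + 1 := by
      by_contra h
      rw [u.pre_of_le (by omega), v.pre_of_le (by omega)] at hmin
      exact lt_irrefl _ hmin
    have e : l - 1 + 1 = l := by omega
    refine ⟨⟨l - 1, by omega⟩, by simpa only [e] using hmin, ?_⟩
    have h1 := pre_succ u.1 (⟨l - 1, by omega⟩ : Fin m).castSucc
    have h2 := v.pre_succ_le (⟨l - 1, by omega⟩ : Fin m).castSucc
    simp only [Fin.val_castSucc, e] at h1 h2
    omega
  -- The largest `s` again: if the next entry of `u` were 0, the deficit would persist, and `s + 1`
  -- would qualify because its entry is below its positive cap.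
  obtain ⟨s, ⟨hs, hpos⟩, hmax⟩ := (Set.toFinite
    {s : Fin m | pre u.1 (s + 1) < pre v.1 (s + 1) ∧
      u.1 s.castSucc < α s.castSucc}).exists_maximal hex
  refine ⟨s, hs, exists_isJump_to u hpos ?_⟩
  have h1 := pre_succ u.1 s.succ
  have h2 := pre_mono v.1 (Nat.le_succ (s + 1))
  simp only [Fin.val_succ, Nat.succ_eq_add_one] at h1 h2
  by_cases hlt : pre u.1 (s + 1 + 1) < pre v.1 (s + 1 + 1)
  · have hsm : (s : ℕ) + 1 < m := by
      by_contra h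
      rw [u.pre_of_le (by omega), v.pre_of_le (by omega)] at hlt
      exact lt_irrefl _ hlt
    by_contra hn
    have h3 := v.pre_succ_le s.succ
    simp only [Fin.val_succ] at h3
    have hle := hmax (y := ⟨s + 1, hsm⟩) ⟨hlt, ?_⟩ (Fin.le_def.2 (Nat.le_succ _))
    · exact absurd (Fin.le_def.1 hle) (by simp)
    · have e : (⟨s + 1, hsm⟩ : Fin m).castSucc = s.succ := rfl
      rw [e]
      have := hα s.succ
      omega
  · omega

/-! ### Heights and cliques -/

/-- The sum of the proper prefix sums. -/
def height (a : Fin (m + 1) → ℕ) : ℕ := ∑ k : Fin m, pre a (k + 1)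

theorem IsJump.height {s : Fin m} {a b : Fin (m + 1) → ℕ} (h : IsJump s a b) :
    height b + 1 = height a := by
  have h1 := fun k : Fin m => (isJump_iff_pre.1 h (k + 1)).symm
  simp only [VeroneseSorting.height, h1, sum_add_distrib, add_left_inj]
  simp [← Fin.ext_iff]

theorem IsJump.above {s : Fin m} {a b : Fin (m + 1) → ℕ} (h : IsJump s a b) : Above a b := by
  intro k
  have := isJump_iff_pre.1 h k
  split_ifs at this <;> omega

theorem height_le {a b : Fin (m + 1) → ℕ} (h : ∀ k, pre b k ≤ pre a k) : height b ≤ height a :=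
  sum_le_sum fun _ _ => h _

theorem Vertex.eq_of_height_le {a b : Vertex d α}
    (h : ∀ k < m, pre b.1 (k + 1) ≤ pre a.1 (k + 1)) (hh : height a.1 ≤ height b.1) : a = b := by
  have h1 : ∀ k ∈ (univ : Finset (Fin m)), pre b.1 (k + 1) ≤ pre a.1 (k + 1) :=
    fun k _ => h k k.2
  have h2 := (sum_eq_sum_iff_of_le h1).1 (le_antisymm (sum_le_sum h1) hh)
  exact Vertex.eq_of_pre_eq fun k hk => (h2 ⟨k, hk⟩ (mem_univ _)).symm

theorem Above.eq_of_height_le {a b : Vertex d α} (h : Above a.1 b.1)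
    (hh : VeroneseSorting.height a.1 ≤ VeroneseSorting.height b.1) : a = b :=
  Vertex.eq_of_height_le (fun _ _ => (h _).1) hh

theorem Above.height_le_add {a b : Fin (m + 1) → ℕ} (h : Above a b) :
    VeroneseSorting.height a ≤ VeroneseSorting.height b + m := by
  calc VeroneseSorting.height a ≤ ∑ k : Fin m, (pre b (k + 1) + 1) :=
        sum_le_sum fun _ _ => (h _).2
    _ = _ := by simp [VeroneseSorting.height, sum_add_distrib]

/-- Any two elements are comparable. -/
def IsSortedFamily (C : Finset (Vertex d α)) : Prop :=
  ∀ a ∈ C, ∀ b ∈ C, Above a.1 b.1 ∨ Above b.1 a.1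

theorem isClique_iff {C : Finset (Vertex d α)} :
    (sortingGraph d α).IsClique (C : Set (Vertex d α)) ↔ IsSortedFamily C := by
  constructor
  · intro h a ha b hb
    by_cases hab : a = b
    · subst hab; exact Or.inl (Above.refl _)
    · exact (sortingGraph_adj_iff.1 (h ha hb hab)).2
  · intro h a ha b hb hab
    exact sortingGraph_adj_iff.2 ⟨hab, h a ha b hb⟩

/-- Heights decide the direction of each comparison: a comparison the other way forces the two
vertices to be equal. So a sorted family is linearly ordered by height. -/
theorem IsSortedFamily.above_of_height_le {C : Finset (Vertex d α)} (hC : IsSortedFamily C)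
    {a b : Vertex d α} (ha : a ∈ C) (hb : b ∈ C) (h : height b.1 ≤ height a.1) :
    Above a.1 b.1 := by
  rcases hC a ha b hb with h' | h'
  · exact h'
  · rw [Above.eq_of_height_le h' h]
    exact Above.refl _

theorem IsSortedFamily.exists_top {C : Finset (Vertex d α)} (hC : IsSortedFamily C)
    (hne : C.Nonempty) : ∃ x ∈ C, ∀ a ∈ C, Above x.1 a.1 := by
  obtain ⟨x, hx, hmax⟩ := C.exists_max_image (fun a => height a.1) hne
  exact ⟨x, hx, fun a ha => hC.above_of_height_le hx ha (hmax a ha)⟩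

theorem IsSortedFamily.exists_bottom {C : Finset (Vertex d α)} (hC : IsSortedFamily C)
    (hne : C.Nonempty) : ∃ y ∈ C, ∀ a ∈ C, Above a.1 y.1 := by
  obtain ⟨y, hy, hmin⟩ := C.exists_min_image (fun a => height a.1) hne
  exact ⟨y, hy, fun a ha => hC.above_of_height_le ha hy (hmin a ha)⟩

/-- Distinct members have distinct heights, and every height is within `m` of the smallest one,
since each of the `m` proper prefix sums varies by at most one. -/
theorem IsSortedFamily.card_le {C : Finset (Vertex d α)} (hC : IsSortedFamily C) :
    #C ≤ m + 1 := by
  rcases C.eq_empty_or_nonempty with rfl | hne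
  · simp
  obtain ⟨y, hy, hbot⟩ := hC.exists_bottom hne
  have : #C ≤ #(Icc (height y.1) (height y.1 + m)) := by
    refine card_le_card_of_injOn (fun a => height a.1) (fun a ha => ?_) fun a ha b hb hab => ?_
    · exact mem_coe.2 (mem_Icc.2 ⟨height_le fun k => (hbot a ha k).1, (hbot a ha).height_le_add⟩)
    · exact (hC.above_of_height_le ha hb (le_of_eq hab.symm)).eq_of_height_le (le_of_eq hab)
  simpa [Nat.card_Icc, add_assoc] using this

end Jumps

/-! ### Maximal cliques are chains of jumps -/

section Chains

variable {m d : ℕ} {α : Fin (m + 1) → ℕ}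

/-- Filling the entries greedily from the right leaves the least possible amount in every prefix;
the truncated subtraction covers the prefixes that stay empty. -/
theorem exists_lowest (hd : d < ∑ i, α i) :
    ∃ l : Vertex d α, ∀ k ≤ m + 1, pre l.1 k = d - (∑ i, α i - pre α k) := by
  refine exists_vertex (fun k => d - (∑ i, α i - pre α k)) ?_ ?_ fun k => ?_
  · simp only [pre_zero]
    omega
  · rw [pre_of_le _ le_rfl]
    omega
  · rw [pre_succ]
    have h1 := pre_succ α k
    have h2 := pre_mono α (show (k : ℕ) + 1 ≤ m + 1 by omega)
    rw [pre_of_le α le_rfl] at h2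
    omega

theorem exists_highest (hd : d < ∑ i, α i) :
    ∃ u : Vertex d α, ∀ k ≤ m + 1, pre u.1 k = min (pre α k) d := by
  refine exists_vertex (fun k => min (pre α k) d) ?_ ?_ fun k => ?_
  · simp
  · rw [pre_of_le _ le_rfl]
    omega
  · rw [pre_succ]
    omega

theorem MaxClique.isSortedFamily (A : MaxClique d α) : IsSortedFamily A.1 :=
  isClique_iff.1 A.2.prop

theorem MaxClique.mem_of_forall (A : MaxClique d α) {u : Vertex d α}
    (hu : ∀ a ∈ A.1, Above a.1 u.1 ∨ Above u.1 a.1) : u ∈ A.1 := by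
  classical
  have h : IsSortedFamily (insert u A.1) := by
    intro a ha b hb
    rcases mem_insert.1 ha with rfl | ha' <;> rcases mem_insert.1 hb with rfl | hb'
    · exact Or.inl (Above.refl _)
    · exact (hu b hb').symm
    · exact hu a ha'
    · exact A.isSortedFamily a ha' b hb'
  exact A.2.le_of_ge (isClique_iff.2 h) (subset_insert u A.1) (mem_insert_self u A.1)

theorem MaxClique.nonempty (hd : d < ∑ i, α i) (A : MaxClique d α) : A.1.Nonempty := by
  obtain ⟨l, -⟩ := exists_lowest hd
  by_contra h
  rw [not_nonempty_iff_eq_empty] at h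
  have := A.mem_of_forall (u := l) (by simp [h])
  simp [h] at this

/-- If top and bottom agreed in a proper prefix sum, there would be room below the bottom or above
the top, because the extreme values of that sum differ. A single jump into this room gives a vertex
comparable to the whole clique, against maximality. -/
theorem MaxClique.pre_top_eq (hα : ∀ i, 1 ≤ α i) (hd : d < ∑ i, α i) (hd0 : 0 < d)
    (A : MaxClique d α) {x y : Vertex d α} (hx : x ∈ A.1)
    (htop : ∀ a ∈ A.1, Above x.1 a.1) (hbot : ∀ a ∈ A.1, Above a.1 y.1) (j : Fin m) :
    pre x.1 (j + 1) = pre y.1 (j + 1) + 1 := by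
  have hj := j.2
  by_contra hne
  have hxy := hbot x hx
  have heq : pre x.1 (j + 1) = pre y.1 (j + 1) := by
    have := hxy (j + 1)
    omega
  obtain ⟨l, hl⟩ := exists_lowest hd
  obtain ⟨u, hu⟩ := exists_highest hd
  have hlu : pre l.1 (j + 1) < pre u.1 (j + 1) := by
    rw [hl _ (by omega), hu _ (by omega)]
    have h1 := pre_succ α j.castSucc
    have h2 := pre_succ α j.succ
    have h3 := hα j.castSucc
    have h4 := hα j.succ
    have h5 := pre_mono α (show (j : ℕ) + 1 + 1 ≤ m + 1 by omega)
    rw [pre_of_le α le_rfl] at h5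
    simp only [Fin.val_castSucc, Fin.val_succ] at h1 h2
    omega
  rcases Nat.lt_or_ge (pre l.1 (j + 1)) (pre y.1 (j + 1)) with hlt | hge
  · obtain ⟨v, hv⟩ := exists_vertex (d := d) (α := α)
      (fun k => max (pre x.1 k - 1) (pre l.1 k)) (by simp)
      (by rw [x.pre_of_le le_rfl, l.pre_of_le le_rfl]; omega) (fun k => by
        have h1 := pre_mono x.1 (Nat.le_succ k)
        have h2 := pre_mono l.1 (Nat.le_succ k)
        have h3 := x.pre_succ_le k
        have h4 := l.pre_succ_le k
        simp only [Nat.succ_eq_add_one] at h1 h2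
        omega)
    obtain ⟨s, hs, w, hw⟩ := exists_isJump_of_pre_lt hα (u := y) (v := v) (k := j + 1)
      (by rw [hv _ (by omega)]; omega)
    rw [hv _ (by omega)] at hs
    have hwA : w ∈ A.1 := A.mem_of_forall fun c hc => Or.inl fun k => by
      have h1 := isJump_iff_pre.1 hw k
      have h2 := hbot c hc k
      have h3 := htop c hc k
      split_ifs at h1 with hk
      · subst hk; omega
      · omega
    have h1 := isJump_iff_pre.1 hw (s + 1)
    have h2 := hbot w hwA (s + 1)
    rw [if_pos rfl] at h1
    omega
  · obtain ⟨v, hv⟩ := exists_vertex (d := d) (α := α)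
      (fun k => min (pre y.1 k + 1) (pre u.1 k)) (by simp)
      (by rw [y.pre_of_le le_rfl, u.pre_of_le le_rfl]; omega) (fun k => by
        have h1 := pre_mono y.1 (Nat.le_succ k)
        have h2 := pre_mono u.1 (Nat.le_succ k)
        have h3 := y.pre_succ_le k
        have h4 := u.pre_succ_le k
        simp only [Nat.succ_eq_add_one] at h1 h2
        omega)
    obtain ⟨s, hs, w, hw⟩ := exists_isJump_to_of_pre_lt hα (u := x) (v := v) (k := j + 1)
      (by rw [hv _ (by omega)]; omega)
    rw [hv _ (by omega)] at hs
    have hwA : w ∈ A.1 := A.mem_of_forall fun c hc => Or.inr fun k => by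
      have h1 := isJump_iff_pre.1 hw k
      have h2 := hbot c hc k
      have h3 := htop c hc k
      split_ifs at h1 with hk
      · subst hk; omega
      · omega
    have h1 := isJump_iff_pre.1 hw (s + 1)
    have h2 := htop w hwA (s + 1)
    rw [if_pos rfl] at h1
    omega

/-- Let `v` be the highest member below `c`. One jump from `c` towards `v` lands between two
neighbours of the chain, so it is comparable to every member and belongs to the maximal clique. -/
theorem MaxClique.exists_isJump_mem (hα : ∀ i, 1 ≤ α i) (A : MaxClique d α) {y c : Vertex d α}
    (hy : y ∈ A.1) (hc : c ∈ A.1) (h : height y.1 < height c.1) :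
    ∃ s : Fin m, ∃ w ∈ A.1, IsJump s c.1 w.1 := by
  classical
  have hA := A.isSortedFamily
  have hne : (A.1.filter fun u => height u.1 < height c.1).Nonempty := by
    use y
    rw [mem_filter]
    exact ⟨hy, h⟩
  obtain ⟨v, hv, hmax⟩ := exists_max_image _ (fun u => height u.1) hne
  obtain ⟨hvA, hvc⟩ := mem_filter.1 hv
  have hcv : Above c.1 v.1 := hA.above_of_height_le hc hvA hvc.le
  obtain ⟨k, hk⟩ : ∃ k, pre v.1 k < pre c.1 k := by
    by_contra! hn
    exact absurd (height_le hn) (not_le.2 hvc)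
  obtain ⟨s, hs, w, hw⟩ := exists_isJump_of_pre_lt hα hk
  have hwv : ∀ k, pre v.1 k ≤ pre w.1 k := fun k => by
    have h1 := isJump_iff_pre.1 hw k
    have h2 := hcv k
    split_ifs at h1 with hk
    · subst hk; omega
    · omega
  have hcw := hw.above
  refine ⟨s, w, A.mem_of_forall fun u hu => ?_, hw⟩
  rcases Nat.lt_or_ge (height u.1) (height c.1) with huc | huc
  · have h1 := hA.above_of_height_le hvA hu (hmax u (mem_filter.2 ⟨hu, huc⟩))
    have h2 := hA.above_of_height_le hc hu huc.le
    refine Or.inr fun k => ?_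
    have := h1 k; have := h2 k; have := hwv k; have := hcw k
    omega
  · have h1 := hA.above_of_height_le hu hc huc
    have h2 := hA.above_of_height_le hu hvA (hvc.le.trans huc)
    refine Or.inl fun k => ?_
    have := h1 k; have := h2 k; have := hwv k; have := hcw k
    omega

/-- Consecutive vertices differ by the jumps of the permutation `s`. -/
def IsJumpChain (s : Equiv.Perm (Fin m)) (a : Fin (m + 1) → Vertex d α) : Prop :=
  ∀ i : Fin m, IsJump (s i) (a i.castSucc).1 (a i.succ).1

theorem MaxClique.exists_chain (hα : ∀ i, 1 ≤ α i) (hd : d < ∑ i, α i) (hd0 : 0 < d)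
    (A : MaxClique d α) : ∃ a s, IsTupleForm A a ∧ IsJumpChain s a := by
  have hA := A.isSortedFamily
  obtain ⟨x, hx, htop⟩ := hA.exists_top (A.nonempty hd)
  obtain ⟨y, hy, hbot⟩ := hA.exists_bottom (A.nonempty hd)
  have hxy : height x.1 = height y.1 + m := by
    rw [height, height, sum_congr rfl fun j _ => A.pre_top_eq hα hd hd0 hx htop hbot j]
    simp [sum_add_distrib]
  have hex : ∀ i : ℕ, i ≤ m → ∃ c ∈ A.1, height c.1 + i = height x.1 := by
    intro i
    induction i with
    | zero => exact fun _ => ⟨x, hx, rfl⟩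
    | succ i ih =>
      intro hi
      obtain ⟨c, hc, hci⟩ := ih (by omega)
      obtain ⟨s, w, hw, hsw⟩ := A.exists_isJump_mem hα hy hc (by omega)
      exact ⟨w, hw, by have := hsw.height; omega⟩
  choose! a ha hah using fun i : Fin (m + 1) => hex i (by omega)
  have huniq : ∀ u ∈ A.1, ∀ v ∈ A.1, height u.1 = height v.1 → u = v := fun u hu v hv h =>
    (hA.above_of_height_le hu hv h.ge).eq_of_height_le h.le
  have hjump : ∀ i : Fin m, ∃ s : Fin m, IsJump s (a i.castSucc).1 (a i.succ).1 := by
    intro i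
    have h1 := hah i.castSucc
    have h2 := hah i.succ
    simp only [Fin.val_castSucc, Fin.val_succ] at h1 h2
    obtain ⟨s, w, hw, hsw⟩ := A.exists_isJump_mem hα hy (ha i.castSucc) (by omega)
    have h3 := hsw.height
    rw [huniq _ (ha i.succ) w hw (by omega)]
    exact ⟨s, hsw⟩
  choose s hs using hjump
  have hab : ∀ i j : Fin (m + 1), i ≤ j → Above (a i).1 (a j).1 := fun i j hij =>
    hA.above_of_height_le (ha i) (ha j) (by
      have := hah i; have := hah j; have := Fin.le_def.1 hij
      omega)
  -- Two jumps at the same place would lower a prefix sum by two, which comparability of the members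
  -- forbids.
  have hne : ∀ i j : Fin m, i < j → s i ≠ s j := by
    intro i j hij h
    have h1 := isJump_iff_pre.1 (hs i) (s i + 1)
    have h2 := isJump_iff_pre.1 (hs j) (s i + 1)
    rw [if_pos rfl] at h1
    rw [h, if_pos rfl] at h2
    rw [h] at h1
    have h3 := hab i.succ j.castSucc (Fin.le_def.2 (by simpa using Fin.lt_def.1 hij)) (s j + 1)
    have h4 := hab i.castSucc j.succ (Fin.le_def.2 (by have := Fin.lt_def.1 hij; simp; omega))
      (s j + 1)
    omega
  have hinj : Function.Injective s := fun i j h => by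
    rcases lt_trichotomy i j with h' | h' | h'
    · exact absurd h (hne i j h')
    · exact h'
    · exact absurd h.symm (hne j i h')
  refine ⟨a, Equiv.ofBijective s (Finite.injective_iff_bijective.1 hinj), ⟨fun i j hij => ?_, ?_⟩,
    hs⟩
  · refine (hab i j hij.le).lexGT fun h => ?_
    have h1 := hah i
    have h2 := hah j
    have := Fin.lt_def.1 hij
    rw [h] at h1
    omega
  · ext u
    refine ⟨fun ⟨i, hi⟩ => hi ▸ ha i, fun hu => ?_⟩
    have h1 := height_le fun k => (htop u hu k).1
    have h2 := height_le fun k => (hbot u hu k).1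
    have h3 := hah ⟨height x.1 - height u.1, by omega⟩
    refine ⟨⟨height x.1 - height u.1, by omega⟩, huniq _ (ha _) u hu ?_⟩
    simp only at h3
    omega

/-! ### Which signatures can be carried out from a given vertex -/

/-- The index of the jump lowering the `k`-th prefix sum; it is `m` if there is none. -/
def pos (s : Equiv.Perm (Fin m)) (k : ℕ) : ℕ :=
  if h : 1 ≤ k ∧ k ≤ m then (s.symm ⟨k - 1, by omega⟩ : ℕ) else m

@[simp] theorem pos_succ (s : Equiv.Perm (Fin m)) (k : Fin m) : pos s (k + 1) = s.symm k := by
  rw [pos, dif_pos (by omega)]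
  rfl

@[simp] theorem pos_zero (s : Equiv.Perm (Fin m)) : pos s 0 = m := by simp [pos]

@[simp] theorem pos_last (s : Equiv.Perm (Fin m)) : pos s (m + 1) = m := by simp [pos]

theorem pos_le (s : Equiv.Perm (Fin m)) (k : ℕ) : pos s k ≤ m := by
  unfold pos
  split_ifs
  · exact (s.symm _).2.le
  · exact le_rfl

theorem pos_eq_iff (s : Equiv.Perm (Fin m)) (k : ℕ) (i : Fin m) : pos s k = i ↔ k = s i + 1 := by
  constructor
  · intro h
    unfold pos at h
    split_ifs at h with hk
    · have : s.symm ⟨k - 1, by omega⟩ = i := Fin.ext h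
      rw [← this]
      simp
      omega
    · omega
  · rintro rfl
    simp

theorem IsJumpChain.pre_add {s : Equiv.Perm (Fin m)} {a : Fin (m + 1) → Vertex d α}
    (h : IsJumpChain s a) (i : Fin (m + 1)) (k : ℕ) :
    pre (a i).1 k + (if pos s k < i then 1 else 0) = pre (a 0).1 k := by
  induction i using Fin.induction with
  | zero => simp
  | succ i ih =>
    have h1 := isJump_iff_pre.1 (h i) k
    have h2 := pos_eq_iff s k i
    simp only [Fin.val_castSucc, Fin.val_succ] at ih ⊢
    split_ifs at ih h1 ⊢ <;> omega

theorem IsJumpChain.apply_add {s : Equiv.Perm (Fin m)} {a : Fin (m + 1) → Vertex d α}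
    (h : IsJumpChain s a) (i k : Fin (m + 1)) :
    (a i).1 k + (if pos s (k + 1) < i then 1 else 0) =
      (a 0).1 k + (if pos s k < i then 1 else 0) := by
  have h1 := h.pre_add i k
  have h2 := h.pre_add i (k + 1)
  rw [pre_succ, pre_succ] at h2
  omega

theorem IsJumpChain.above {s : Equiv.Perm (Fin m)} {a : Fin (m + 1) → Vertex d α}
    (h : IsJumpChain s a) {i j : Fin (m + 1)} (hij : i ≤ j) : Above (a i).1 (a j).1 := fun k => by
  have h1 := h.pre_add i k
  have h2 := h.pre_add j k
  have := Fin.le_def.1 hij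
  split_ifs at h1 h2 <;> omega

theorem IsJumpChain.height_add {s : Equiv.Perm (Fin m)} {a : Fin (m + 1) → Vertex d α}
    (h : IsJumpChain s a) (i : Fin (m + 1)) : height (a i).1 + i = height (a 0).1 := by
  induction i using Fin.induction with
  | zero => simp
  | succ i ih =>
    have := (h i).height
    simp only [Fin.val_castSucc, Fin.val_succ] at ih ⊢
    omega

theorem IsJumpChain.injective {s : Equiv.Perm (Fin m)} {a : Fin (m + 1) → Vertex d α}
    (h : IsJumpChain s a) : Function.Injective a := fun i j hij => by
  have h1 := h.height_add i
  have h2 := h.height_add j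
  rw [hij] at h1
  exact Fin.ext (by omega)

/-- A chain of jumps is a clique with `m + 1` members, the largest possible number, and is therefore
maximal. -/
theorem IsJumpChain.exists_maxClique {s : Equiv.Perm (Fin m)} {a : Fin (m + 1) → Vertex d α}
    (h : IsJumpChain s a) : ∃ A : MaxClique d α, IsTupleForm A a := by
  classical
  have hS : IsSortedFamily (univ.image a) := by
    intro u hu v hv
    obtain ⟨i, -, rfl⟩ := mem_image.1 hu
    obtain ⟨j, -, rfl⟩ := mem_image.1 hv
    exact (le_total i j).imp h.above h.above
  refine ⟨⟨univ.image a, isClique_iff.2 hS, fun C hC hle => ?_⟩, fun i j hij => ?_, by simp⟩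
  · refine (eq_of_subset_of_card_le hle ?_).ge
    rw [card_image_of_injective _ h.injective, card_univ, Fintype.card_fin]
    exact (isClique_iff.1 hC).card_le
  · exact (h.above hij.le).lexGT fun h' => hij.ne (h.injective (Subtype.ext h'))

theorem IsTupleForm.unique {A : MaxClique d α} {a b : Fin (m + 1) → Vertex d α}
    (ha : IsTupleForm A a) (hb : IsTupleForm A b) : a = b := by
  have key : ∀ {c}, IsTupleForm A c → StrictMono fun i => OrderDual.toDual (toLex (c i).1) :=
    fun hc i j hij => hc.1 i j hij
  have := ((key ha).range_inj (key hb)).1 (by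
    have h : ∀ c : Fin (m + 1) → Vertex d α, (Set.range fun i => OrderDual.toDual (toLex (c i).1))
        = (fun v : Vertex d α => OrderDual.toDual (toLex v.1)) '' Set.range c :=
      fun c => Set.range_comp (fun v : Vertex d α => OrderDual.toDual (toLex v.1)) c
    rw [h, h, ha.2, hb.2])
  funext i
  exact Subtype.ext (toLex.injective (OrderDual.toDual.injective (congrFun this i)))

theorem IsJumpChain.signature_unique {s t : Equiv.Perm (Fin m)} {a : Fin (m + 1) → Vertex d α}
    (hs : IsJumpChain s a) (ht : IsJumpChain t a) : s = t := by
  ext i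
  have h1 := isJump_iff_pre.1 (hs i) (s i + 1)
  have h2 := isJump_iff_pre.1 (ht i) (s i + 1)
  split_ifs at h1 h2 <;> omega

theorem IsJumpChain.unique {s : Equiv.Perm (Fin m)} {a b : Fin (m + 1) → Vertex d α}
    (ha : IsJumpChain s a) (hb : IsJumpChain s b) (h : a 0 = b 0) : a = b := by
  funext i
  refine Subtype.ext (eq_of_pre_eq fun k _ => ?_)
  have h1 := ha.pre_add i k
  have h2 := hb.pre_add i k
  rw [h] at h1
  omega

/-- The jumps of `s` can be carried out one after the other from `x`. -/
def Fits (x : Vertex d α) (s : Equiv.Perm (Fin m)) : Prop :=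
  ∀ k : Fin (m + 1), (x.1 k = 0 → pos s k ≤ pos s (k + 1)) ∧
    (x.1 k = α k → pos s (k + 1) ≤ pos s k)

/-- Entry `k` gains a unit at time `pos s k` and loses one at time `pos s (k + 1)`. An empty entry
must gain first, a full one must lose first. The value `m` at both ends means never: the first entry
cannot gain and the last cannot lose. -/
theorem IsJumpChain.fits {s : Equiv.Perm (Fin m)} {a : Fin (m + 1) → Vertex d α}
    (h : IsJumpChain s a) : Fits (a 0) s := by
  intro k
  have hk := pos_le s k
  have hk' := pos_le s (k + 1)
  constructor
  · intro h0
    by_contra hlt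
    have := h.apply_add ⟨pos s (k + 1) + 1, by omega⟩ k
    simp only at this
    split_ifs at this <;> omega
  · intro h0
    by_contra hlt
    have := h.apply_add ⟨pos s k + 1, by omega⟩ k
    have h1 := (a ⟨pos s k + 1, by omega⟩).2.2 k
    simp only at this
    split_ifs at this <;> omega

theorem Fits.exists_chain {x : Vertex d α} {s : Equiv.Perm (Fin m)} (h : Fits x s)
    (hα : ∀ i, 1 ≤ α i) : ∃ a : Fin (m + 1) → Vertex d α, a 0 = x ∧ IsJumpChain s a := by
  -- The first entry is positive, as it never gains but loses a unit. Hence the truncated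
  -- subtraction used below is exact.
  have hpos : ∀ k, 1 ≤ k → k ≤ m → 0 < pre x.1 k := by
    intro k hk hk'
    have h0 : 0 < pre x.1 1 := by
      have h1 := pre_succ x.1 0
      have h2 := (h 0).1
      have h3 := pos_succ s ⟨0, by omega⟩
      have h4 := (s.symm ⟨0, by omega⟩).2
      simp only [Fin.val_zero, zero_add, pos_zero, pre_zero] at h1 h2 h3
      by_contra h5
      have := h2 (by omega)
      omega
    exact h0.trans_le (pre_mono _ hk)
  have hex : ∀ i : Fin (m + 1), ∃ b : Vertex d α, ∀ k ≤ m + 1,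
      pre b.1 k = pre x.1 k - if pos s k < i then 1 else 0 := by
    intro i
    have hi := i.2
    refine exists_vertex _ (by simp) ?_ fun k => ?_
    · rw [pos_last, if_neg (by omega), x.pre_of_le le_rfl]
      rfl
    · have h1 := h k
      have h2 := x.2.2 k
      have h3 := pre_succ x.1 k
      have h4 : pos s k < i → 0 < pre x.1 k := fun h => by
        rcases Nat.eq_zero_or_pos (k : ℕ) with h0 | h0
        · rw [h0, pos_zero] at h
          omega
        · exact hpos _ h0 (by omega)
      have h5 := hα k
      split_ifs <;> omega
  choose a ha using hex
  have key : ∀ i : Fin (m + 1), ∀ k,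
      pre (a i).1 k + (if pos s k < i then 1 else 0) = pre x.1 k := by
    intro i k
    have hi := i.2
    rcases Nat.lt_or_ge m k with hk | hk
    · rw [(a i).pre_of_le hk, x.pre_of_le hk, pos, dif_neg (by omega), if_neg (by omega)]
      rfl
    · have h1 := ha i k (by omega)
      rcases Nat.eq_zero_or_pos k with h0 | h0
      · subst h0
        simp only [pos_zero, pre_zero]
        rw [if_neg (by omega)]
      · have := hpos k h0 hk
        split_ifs at h1 ⊢ <;> omega
  refine ⟨a, Vertex.eq_of_pre_eq fun k _ => by simpa using key 0 (k + 1), fun i => ?_⟩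
  refine isJump_iff_pre.2 fun k => ?_
  have h1 := key i.castSucc k
  have h2 := key i.succ k
  have h3 := pos_eq_iff s k i
  simp only [Fin.val_castSucc, Fin.val_succ] at h1 h2
  split_ifs at h1 h2 ⊢ <;> omega

end Chains

/-! ### Flips -/

section Flips

variable {m d : ℕ} {α : Fin (m + 1) → ℕ}

theorem height_eq_sum_mul (a : Fin (m + 1) → ℕ) :
    height a = ∑ j : Fin m, a j.castSucc * (m - j) := by
  have h1 : ∀ j : Fin (m + 1), ∑ k : Fin m, (if (j : ℕ) < k + 1 then a j else 0) =
      a j * (m - j) := by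
    intro j
    rw [← sum_filter, sum_const, smul_eq_mul, mul_comm]
    congr 1
    rcases Nat.lt_or_ge j m with hj | hj
    · have : ({k : Fin m | (j : ℕ) < k + 1} : Finset (Fin m)) = Ici ⟨j, hj⟩ := by
        ext k
        rw [mem_filter, mem_Ici, Fin.le_def, Nat.lt_succ_iff]
        simp
      rw [this, Fin.card_Ici]
    · rw [Nat.sub_eq_zero_of_le hj, card_eq_zero, filter_eq_empty_iff]
      intro k _
      omega
  simp only [height, pre]
  rw [sum_comm, sum_congr rfl fun j _ => h1 j, Fin.sum_univ_castSucc]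
  simp

/-- Entry `j` is counted in `m - j` proper prefix sums, which is its weight in the rank. -/
theorem tupleRank_eq (η a : Fin (m + 1) → ℕ) : tupleRank η a = (height a : ℤ) - height η := by
  rw [height_eq_sum_mul, height_eq_sum_mul, tupleRank]
  push_cast
  rw [← sum_sub_distrib]
  refine sum_congr rfl fun j _ => ?_
  rw [Nat.cast_sub j.2.le]
  ring

theorem hasRank_iff {A : MaxClique d α} {s : Equiv.Perm (Fin m)} {a : Fin (m + 1) → Vertex d α}
    (ha : IsTupleForm A a) (hs : IsJumpChain s a) (η : Vertex d α) (r : ℤ) :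
    HasRank η A r ↔ r = (height (a 0).1 : ℤ) - m - height η.1 := by
  have h := hs.height_add (Fin.last m)
  simp only [Fin.val_last] at h
  constructor
  · rintro ⟨b, hb, rfl⟩
    rw [hb.unique ha, tupleRank_eq]
    omega
  · rintro rfl
    refine ⟨a, ha, ?_⟩
    rw [tupleRank_eq]
    omega

theorem hasSignature_iff {A : MaxClique d α} {s : Equiv.Perm (Fin m)}
    {a : Fin (m + 1) → Vertex d α} (ha : IsTupleForm A a) (hs : IsJumpChain s a)
    (t : Equiv.Perm (Fin m)) : HasSignature A t ↔ t = s := by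
  constructor
  · rintro ⟨b, hb, ht⟩
    rw [hb.unique ha] at ht
    exact IsJumpChain.signature_unique ht hs
  · rintro rfl
    exact ⟨a, ha, hs⟩

theorem equivalent_iff {A B : MaxClique d α} {a b : Fin (m + 1) → Vertex d α}
    (ha : IsTupleForm A a) (hb : IsTupleForm B b) : Equivalent A B ↔ a 0 = b 0 := by
  constructor
  · rintro ⟨a', b', ha', hb', h⟩
    rwa [ha'.unique ha, hb'.unique hb] at h
  · exact fun h => ⟨a, b, ha, hb, h⟩

theorem IsTupleForm.mem_iff {A : MaxClique d α} {a : Fin (m + 1) → Vertex d α}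
    (ha : IsTupleForm A a) {u : Vertex d α} : u ∈ A.1 ↔ ∃ i, a i = u := by
  rw [← mem_coe, ← ha.2, Set.mem_range]

theorem IsTupleForm.eq {A B : MaxClique d α} {a : Fin (m + 1) → Vertex d α}
    (ha : IsTupleForm A a) (hb : IsTupleForm B a) : A = B := by
  refine Subtype.ext (Finset.ext fun u => ?_)
  rw [ha.mem_iff, hb.mem_iff]

/-- The permutation `s` with its entries at the places `t` and `t + 1` interchanged. -/
def swapAt (s : Equiv.Perm (Fin m)) (t : ℕ) (ht : t + 1 < m) : Equiv.Perm (Fin m) :=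
  (Equiv.swap ⟨t, by omega⟩ ⟨t + 1, ht⟩).trans s

theorem pos_swapAt (s : Equiv.Perm (Fin m)) (t : ℕ) (ht : t + 1 < m) (k : ℕ) :
    pos (swapAt s t ht) k =
      if pos s k = t then t + 1 else if pos s k = t + 1 then t else pos s k := by
  by_cases hk : 1 ≤ k ∧ k ≤ m
  · have h1 : pos (swapAt s t ht) k =
        Equiv.swap (⟨t, by omega⟩ : Fin m) ⟨t + 1, ht⟩ (s.symm ⟨k - 1, by omega⟩) := by
      rw [pos, dif_pos hk]
      simp [swapAt]
    have h2 : pos s k = s.symm ⟨k - 1, by omega⟩ := by rw [pos, dif_pos hk]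
    rw [h1, h2, Equiv.swap_apply_def]
    simp only [Fin.ext_iff]
    split_ifs <;> rfl
  · rw [pos, pos, dif_neg hk, dif_neg hk, if_neg (by omega), if_neg (by omega)]

/-- Fitting is a set of conditions on the order of pairs of jumps. The swap changes the order of one
pair only, and the new order is the one in `τ`, which fits. -/
theorem Fits.swapAt {x : Vertex d α} {s τ : Equiv.Perm (Fin m)} (hs : Fits x s) (hτ : Fits x τ)
    (t : ℕ) (ht : t + 1 < m)
    (hdesc : τ.symm (s ⟨t + 1, ht⟩) < τ.symm (s ⟨t, by omega⟩)) : Fits x (swapAt s t ht) := by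
  have key : ∀ k l, (pos τ k ≤ pos τ l) → (pos s k ≤ pos s l) →
      pos (VeroneseSorting.swapAt s t ht) k ≤ pos (VeroneseSorting.swapAt s t ht) l := by
    intro k l h1 h2
    rw [pos_swapAt, pos_swapAt]
    by_cases h : pos s k = t ∧ pos s l = t + 1
    · have e1 := (pos_eq_iff s k ⟨t, by omega⟩).1 h.1
      have e2 := (pos_eq_iff s l ⟨t + 1, ht⟩).1 h.2
      rw [show pos τ k = _ from congrArg _ e1, show pos τ l = _ from congrArg _ e2, pos_succ,
        pos_succ] at h1
      exact absurd hdesc (not_lt.2 (Fin.le_def.2 h1))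
    · split_ifs <;> omega
  intro k
  exact ⟨fun h => key _ _ ((hτ k).1 h) ((hs k).1 h), fun h => key _ _ ((hτ k).2 h) ((hs k).2 h)⟩

/-- Exchanging two consecutive jumps replaces a single inner vertex. -/
theorem IsJumpChain.exists_swap (hα : ∀ i, 1 ≤ α i) {s τ : Equiv.Perm (Fin m)}
    {a : Fin (m + 1) → Vertex d α} (hs : IsJumpChain s a) (hτ : Fits (a 0) τ)
    (t : ℕ) (ht : t + 1 < m) (hdesc : τ.symm (s ⟨t + 1, ht⟩) < τ.symm (s ⟨t, by omega⟩)) :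
    ∃ c : Fin (m + 1) → Vertex d α, IsJumpChain (swapAt s t ht) c ∧
      ∀ i : Fin (m + 1), (i : ℕ) ≠ t + 1 → c i = a i := by
  obtain ⟨c, hc0, hc⟩ := (hs.fits.swapAt hτ t ht hdesc).exists_chain hα
  refine ⟨c, hc, fun i hi => Subtype.ext (eq_of_pre_eq fun k _ => ?_)⟩
  have h1 := hs.pre_add i k
  have h2 := hc.pre_add i k
  rw [pos_swapAt, hc0] at h2
  split_ifs at h1 h2 <;> omega

theorem relSignature_swapAt_lt {s τ : Equiv.Perm (Fin m)} (t : ℕ) (ht : t + 1 < m)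
    (hdesc : τ.symm (s ⟨t + 1, ht⟩) < τ.symm (s ⟨t, by omega⟩)) :
    toLex (relSignature τ (swapAt s t ht)) < toLex (relSignature τ s) := by
  refine ⟨⟨t, by omega⟩, fun j hj => ?_, ?_⟩
  · have := Fin.lt_def.1 hj
    change τ.symm (s (Equiv.swap _ _ j)) = τ.symm (s j)
    rw [Equiv.swap_apply_of_ne_of_ne] <;> simp only [ne_eq, Fin.ext_iff] <;> simp only at this <;>
      omega
  · change τ.symm (s (Equiv.swap _ _ _)) < τ.symm (s _)
    rw [Equiv.swap_apply_left]
    exact hdesc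

theorem IsJumpChain.last_add {s : Equiv.Perm (Fin m)} {a : Fin (m + 1) → Vertex d α}
    (hs : IsJumpChain s a) (k : Fin (m + 1)) :
    (a (Fin.last m)).1 k + (if (k : ℕ) < m then 1 else 0) =
      (a 0).1 k + (if 1 ≤ (k : ℕ) then 1 else 0) := by
  have h := hs.apply_add (Fin.last m) k
  have key : ∀ k, pos s k < m ↔ 1 ≤ k ∧ k ≤ m := by
    intro k
    unfold pos
    split_ifs with hk <;> simp [hk]
  simp only [Fin.val_last, key] at h
  have := k.2
  split_ifs at h ⊢ <;> omega

theorem IsJumpChain.last_pre_add {s : Equiv.Perm (Fin m)} {a : Fin (m + 1) → Vertex d α}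
    (hs : IsJumpChain s a) (k : Fin m) :
    pre (a (Fin.last m)).1 (k + 1) + 1 = pre (a 0).1 (k + 1) := by
  have h := hs.pre_add (Fin.last m) (k + 1)
  rw [pos_succ, if_pos (by simp)] at h
  exact h

/-- Dropping the first vertex of a chain and repeating the first jump at the end. -/
theorem IsJumpChain.exists_rotate {n : ℕ} {α : Fin (n + 1 + 1) → ℕ}
    {s : Equiv.Perm (Fin (n + 1))} {a : Fin (n + 1 + 1) → Vertex d α} (hs : IsJumpChain s a)
    {z : Vertex d α} (hz : IsJump (s 0) (a (Fin.last (n + 1))).1 z.1) :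
    ∃ s' c, IsJumpChain (d := d) (α := α) s' c ∧ ∀ i : Fin (n + 1), c i.castSucc = a i.succ := by
  refine ⟨(finRotate (n + 1)).trans s, Fin.snoc (α := fun _ => Vertex d α) (fun i => a i.succ) z,
    fun i => ?_, fun i => by simp⟩
  rw [Fin.snoc_castSucc]
  induction i using Fin.lastCases with
  | last =>
    rw [Equiv.trans_apply, finRotate_last, Fin.succ_last, Fin.snoc_last]
    exact hz
  | cast i =>
    have h1 : finRotate (n + 1) i.castSucc = i.succ := by
      rw [finRotate_apply]
      exact Fin.coeSucc_eq_succ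
    rw [Equiv.trans_apply, h1, Fin.succ_castSucc, Fin.snoc_castSucc]
    have := hs i.succ
    rwa [← Fin.succ_castSucc] at this

/-- The last vertex differs from the first one only by a unit moved from the first entry to the
last. So the first jump can be repeated there unless it takes from a first entry that was 1 or adds
to a last entry that was one below its cap. -/
theorem IsJumpChain.exists_isJump_last (hm : 2 ≤ m) {s : Equiv.Perm (Fin m)}
    {a : Fin (m + 1) → Vertex d α} (hs : IsJumpChain s a) (i : Fin m) (hi : (i : ℕ) = 0)
    (h0 : ¬ ((s i : ℕ) = 0 ∧ (a 0).1 0 = 1))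
    (h1 : ¬ ((s i : ℕ) + 1 = m ∧ (a 0).1 (Fin.last m) + 1 = α (Fin.last m))) :
    ∃ z : Vertex d α, IsJump (s i) (a (Fin.last m)).1 z.1 := by
  have hsi := (s i).2
  have e0 : i.castSucc = 0 := Fin.ext hi
  obtain ⟨j1, j2, -⟩ := hs i
  have j3 := (a i.succ).2.2 (s i).succ
  have l1 := hs.last_add (s i).castSucc
  have l2 := hs.last_add (s i).succ
  rw [e0] at j1 j2
  simp only [Fin.val_castSucc, Fin.val_succ] at l1 l2
  refine exists_isJump _ ?_ ?_
  · by_cases h : (s i : ℕ) = 0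
    · have : (s i).castSucc = 0 := Fin.ext h
      have e : (a 0).1 (s i).castSucc = (a 0).1 0 := congrArg _ this
      split_ifs at l1 <;> omega
    · split_ifs at l1 <;> omega
  · by_cases h : (s i : ℕ) + 1 = m
    · have : (s i).succ = Fin.last m := Fin.ext h
      have e : (a 0).1 (s i).succ = (a 0).1 (Fin.last m) := congrArg _ this
      have e' : α (s i).succ = α (Fin.last m) := congrArg _ this
      split_ifs at l2 <;> omega
    · split_ifs at l2 <;> omega

/-! ### Tight places and descents -/

/-- The prefix sum of `x` after the `k`-th entry is as small as it can be for the first vertex of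
a maximal clique, because all entries before it, or all entries after it, are extremal. -/
def Tight (x : Vertex d α) (k : Fin m) : Prop :=
  (x.1 0 = 1 ∧ ∀ j : Fin (m + 1), 1 ≤ (j : ℕ) → (j : ℕ) ≤ k → x.1 j = 0) ∨
  (x.1 (Fin.last m) + 1 = α (Fin.last m) ∧
    ∀ j : Fin (m + 1), (k : ℕ) + 1 ≤ j → (j : ℕ) < m → x.1 j = α j)

/-- A proper prefix sum of a first vertex is one more than that of the last vertex. The latter is at
least 0 and at least `d` minus the caps of the remaining entries; tightness of `x` means equality in
one of these bounds. -/
theorem Tight.pre_le {x : Vertex d α} {k : Fin m} (h : Tight x k) {s : Equiv.Perm (Fin m)}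
    {b : Fin (m + 1) → Vertex d α} (hs : IsJumpChain s b) :
    pre x.1 (k + 1) ≤ pre (b 0).1 (k + 1) := by
  have hk := k.2
  rw [← hs.last_pre_add]
  rcases h with ⟨h0, h⟩ | ⟨h0, h⟩
  · have key : ∀ l ≤ (k : ℕ), pre x.1 (l + 1) = 1 := by
      intro l
      induction l with
      | zero =>
        intro _
        have := pre_succ x.1 0
        simpa [h0] using this
      | succ l ih =>
        intro hl
        have h1 := pre_succ x.1 ⟨l + 1, by omega⟩
        have h2 := h ⟨l + 1, by omega⟩ (by simp) hl
        simp only at h1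
        rw [h1, ih (by omega), h2]
    rw [key k le_rfl]
    omega
  · have key : ∀ l, l + (k + 1) ≤ m →
        pre x.1 (m - l) ≤ pre (b (Fin.last m)).1 (m - l) + 1 := by
      intro l
      induction l with
      | zero =>
        intro _
        have h1 := pre_succ x.1 (Fin.last m)
        have h2 := (b (Fin.last m)).pre_succ_le (Fin.last m)
        rw [Fin.val_last, x.pre_of_le le_rfl] at h1
        rw [Fin.val_last, Vertex.pre_of_le _ le_rfl] at h2
        simp only [Nat.sub_zero]
        omega
      | succ l ih =>
        intro hl
        have h1 := pre_succ x.1 ⟨m - (l + 1), by omega⟩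
        have h2 := (b (Fin.last m)).pre_succ_le ⟨m - (l + 1), by omega⟩
        have h3 := h ⟨m - (l + 1), by omega⟩ (by simp only; omega) (by simp only; omega)
        have h4 := ih (by omega)
        have e : m - (l + 1) + 1 = m - l := by omega
        simp only [e] at h1 h2
        omega
    have := key (m - (k + 1)) (by omega)
    rwa [Nat.sub_sub_self hk] at this

theorem exists_first_descent {σ : ℕ → ℕ} {M : ℕ} (h : ∃ t, t + 1 < M ∧ σ (t + 1) < σ t) :
    ∃ t, t + 1 < M ∧ σ (t + 1) < σ t ∧ ∀ j ≤ t, σ 0 ≤ σ j := by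
  classical
  refine ⟨Nat.find h, (Nat.find_spec h).1, (Nat.find_spec h).2, fun j => ?_⟩
  induction j with
  | zero => exact fun _ => le_rfl
  | succ j ih =>
    intro hj
    have h1 := Nat.find_min h (m := j) (by omega)
    have h2 := (Nat.find_spec h).1
    have := ih (by omega)
    by_contra hn
    exact h1 ⟨by omega, by omega⟩

theorem exists_descent_between {σ : ℕ → ℕ} {i l : ℕ} (hil : i ≤ l) (h : σ l < σ i) :
    ∃ t, i ≤ t ∧ t < l ∧ σ (t + 1) < σ t := by
  by_contra! hn
  induction l, hil using Nat.le_induction with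
  | base => exact lt_irrefl _ h
  | succ l hl ih =>
    have := hn l hl (Nat.lt_succ_self l)
    exact ih (by omega) fun t h1 h2 => hn t h1 (by omega)

/-- The place of the `i`-th jump of `s` in the permutation `τ`. -/
def relPos (τ s : Equiv.Perm (Fin m)) (i : ℕ) : ℕ :=
  if h : i < m then τ.symm (s ⟨i, h⟩) else 0

theorem relPos_eq (τ s : Equiv.Perm (Fin m)) (i : Fin m) : relPos τ s i = τ.symm (s i) := by
  rw [relPos, dif_pos i.2]

/-- Let `i` be the first place where the signatures differ. The jump `t i` occurs later in `s`, and
from place `i` to that place the positions in `τ` drop, so there is a descent between them. The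
vertex of `A` inside this descent has not yet made the jump `t i`; the vertex of `B` of equal height
has. -/
theorem exists_descent_of_relSignature_lt {s t τ : Equiv.Perm (Fin m)}
    {a b : Fin (m + 1) → Vertex d α} (ha : IsJumpChain s a) (hb : IsJumpChain t b)
    (h0 : a 0 = b 0) (hlt : toLex (relSignature τ t) < toLex (relSignature τ s)) :
    ∃ r, ∃ hr : r + 1 < m, τ.symm (s ⟨r + 1, hr⟩) < τ.symm (s ⟨r, by omega⟩) ∧
      ∀ j, b j ≠ a ⟨r + 1, by omega⟩ := by
  obtain ⟨i, hi, hlt⟩ := hlt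
  have hi : ∀ j < i, t j = s j := fun j hj => τ.symm.injective (hi j hj)
  have hlt : τ.symm (t i) < τ.symm (s i) := hlt
  set l := s.symm (t i) with hl
  have hsl : s l = t i := by simp [hl]
  have hil : i < l := by
    rcases lt_trichotomy i l with h | h | h
    · exact h
    · rw [h, hsl, ← h] at hlt
      exact absurd hlt (lt_irrefl _)
    · have := hi l h
      rw [hsl] at this
      exact absurd (t.injective this) h.ne
  obtain ⟨r, h1, h2, h3⟩ := exists_descent_between (σ := relPos τ s) (Fin.le_def.1 hil.le)
    (by rw [relPos_eq, relPos_eq, hsl]; exact hlt)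
  have hr : r + 1 < m := by omega
  refine ⟨r, hr, ?_, fun j hj => ?_⟩
  · rw [relPos, relPos, dif_pos hr, dif_pos (by omega)] at h3
    exact h3
  · have e1 := ha.height_add ⟨r + 1, by omega⟩
    have e2 := hb.height_add j
    rw [hj, ← h0] at e2
    have e3 : j = ⟨r + 1, by omega⟩ := Fin.ext (by omega)
    have e4 := ha.pre_add ⟨r + 1, by omega⟩ (t i + 1)
    have e5 := hb.pre_add j (t i + 1)
    rw [hj, ← h0, e3] at e5
    rw [pos_succ] at e4 e5
    rw [Equiv.symm_apply_apply] at e5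
    rw [← hl, if_neg (by simp only; omega)] at e4
    rw [if_pos (by simp only; omega)] at e5
    omega

theorem exists_descent_of_tight {s t τ : Equiv.Perm (Fin m)} {a b : Fin (m + 1) → Vertex d α}
    (ha : IsJumpChain s a) (hb : IsJumpChain t b) (hne : b 0 ≠ a 0)
    (hle : height (b 0).1 ≤ height (a 0).1)
    (hup : ∀ i j, i ≤ j → Tight (a 0) (τ i) → Tight (a 0) (τ j))
    (i : Fin m) (hi : (i : ℕ) = 0) (htight : Tight (a 0) (s i)) :
    ∃ r, ∃ hr : r + 1 < m, τ.symm (s ⟨r + 1, hr⟩) < τ.symm (s ⟨r, by omega⟩) ∧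
      ∀ j, b j ≠ a ⟨r + 1, by omega⟩ := by
  have hm := i.2
  have hup' : ∀ j : Fin m, relPos τ s 0 ≤ relPos τ s j → Tight (a 0) (s j) := by
    intro j hj
    rw [relPos_eq, ← hi, relPos_eq] at hj
    have := hup (τ.symm (s i)) (τ.symm (s j)) (Fin.le_def.2 hj) (by simpa using htight)
    simpa using this
  by_cases hdesc : ∃ r, r + 1 < m ∧ relPos τ s (r + 1) < relPos τ s r
  · obtain ⟨r, hr, h1, h2⟩ := exists_first_descent hdesc
    refine ⟨r, hr, ?_, fun j hj => hne ?_⟩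
    · rw [relPos, relPos, dif_pos hr, dif_pos (by omega)] at h1
      exact h1
    -- If the removed vertex were in `B`, then `b 0` would dominate `a 0`: at places not yet lowered
    -- because `b 0` lies above that vertex, at the others because they are tight.
    · refine Vertex.eq_of_height_le (fun k hk => ?_) hle
      rcases Nat.lt_or_ge r (s.symm ⟨k, hk⟩) with hlt | hge
      · have h3 := ha.pre_add ⟨r + 1, by omega⟩ (k + 1)
        have h4 := (hb.above (Fin.zero_le j) (k + 1)).1
        have h5 := pos_succ s ⟨k, hk⟩
        simp only at h5
        rw [h5, if_neg (by simp only; omega), ← hj] at h3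
        omega
      · have h3 := hup' (s.symm ⟨k, hk⟩) (h2 _ hge)
        rw [Equiv.apply_symm_apply] at h3
        exact h3.pre_le hb
  · exfalso
    refine hne (Vertex.eq_of_height_le (fun k hk => ?_) hle)
    have h3 := hup' (s.symm ⟨k, hk⟩) (by
      by_contra hn
      obtain ⟨r, -, h1, h2⟩ := exists_descent_between (Nat.zero_le _) (not_le.1 hn)
      exact hdesc ⟨r, by omega, h2⟩)
    rw [Equiv.apply_symm_apply] at h3
    exact h3.pre_le hb

end Flips

/-! ### Special signatures -/

section Special

variable {m d : ℕ} {α : Fin (m + 1) → ℕ}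

theorem succ_le_kappa₁_iff (a : Fin (m + 1) → ℕ) (k : Fin m) :
    (k : ℕ) + 1 ≤ kappa₁ a ↔
      a 0 = 1 ∧ ∀ j : Fin (m + 1), 1 ≤ (j : ℕ) → (j : ℕ) ≤ k → a j = 0 := by
  have hk := k.2
  unfold kappa₁
  split_ifs with h
  · constructor
    · intro hle
      refine ⟨h, fun j h1 h2 => ?_⟩
      exact Nat.findGreatest_spec (P := fun k => ∀ j : Fin (m + 1), 2 ≤ (j : ℕ) + 1 →
        (j : ℕ) + 1 ≤ k → a j = 0) (Nat.zero_le m) (fun j h3 h4 => by omega) j (by omega) (by omega)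
    · rintro ⟨-, h'⟩
      exact Nat.le_findGreatest (by omega) fun j h3 h4 => h' j (by omega) (by omega)
  · simp [h]

theorem kappa₁_le (a : Fin (m + 1) → ℕ) : kappa₁ a ≤ m := by
  unfold kappa₁
  split_ifs
  · exact Nat.findGreatest_le m
  · exact Nat.zero_le m

theorem kappa₂_le_iff (α a : Fin (m + 1) → ℕ) (k : Fin m) :
    kappa₂ α a ≤ k + 2 ↔ a (Fin.last m) + 1 = α (Fin.last m) ∧
      ∀ j : Fin (m + 1), (k : ℕ) + 1 ≤ j → (j : ℕ) < m → a j = α j := by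
  have hk := k.2
  unfold kappa₂
  split_ifs with h
  · constructor
    · intro hle
      refine ⟨h, fun j h1 h2 => ?_⟩
      -- The set contains `m + 1` vacuously, so the infimum is attained and is not the default value
      -- 0.
      have hmem := Nat.sInf_mem (s := {k | 2 ≤ k ∧ ∀ j : Fin (m + 1), k ≤ (j : ℕ) + 1 →
        (j : ℕ) + 1 ≤ m → a j = α j}) ⟨m + 1, by omega, fun j h3 h4 => by omega⟩
      exact hmem.2 j (by omega) (by omega)
    · rintro ⟨-, h'⟩
      exact Nat.sInf_le ⟨by omega, fun j h3 h4 => h' j (by omega) (by omega)⟩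
  · simp only [h, false_and, iff_false]
    omega

theorem two_le_kappa₂ (hm : 1 ≤ m) (α a : Fin (m + 1) → ℕ) : 2 ≤ kappa₂ α a := by
  unfold kappa₂
  split_ifs
  · exact (Nat.sInf_mem (s := {k | 2 ≤ k ∧ ∀ j : Fin (m + 1), k ≤ (j : ℕ) + 1 →
        (j : ℕ) + 1 ≤ m → a j = α j}) ⟨m + 1, by omega, fun j h3 h4 => by omega⟩).1
  · omega

theorem kappa₂_le (hm : 1 ≤ m) (α a : Fin (m + 1) → ℕ) : kappa₂ α a ≤ m + 2 := by
  unfold kappa₂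
  split_ifs
  · exact Nat.sInf_le ⟨by omega, fun j h3 h4 => by omega⟩
  · exact le_rfl

/-- Otherwise the entry numbered `κ₂` (from 1) would be both 0 and equal to its positive cap. -/
theorem kappa₁_lt_kappa₂ (hm : 1 ≤ m) (hα : ∀ i, 1 ≤ α i) (a : Fin (m + 1) → ℕ) :
    kappa₁ a < kappa₂ α a := by
  by_contra h
  have h1 := kappa₁_le a
  have h2 := two_le_kappa₂ hm α a
  obtain ⟨-, h3⟩ := (succ_le_kappa₁_iff a ⟨kappa₂ α a - 1, by omega⟩).1 (by simp only; omega)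
  obtain ⟨-, h4⟩ := (kappa₂_le_iff α a ⟨kappa₂ α a - 2, by omega⟩).1 (by simp only; omega)
  have h5 := h3 ⟨kappa₂ α a - 1, by omega⟩ (by simp only; omega) le_rfl
  have h6 := h4 ⟨kappa₂ α a - 1, by omega⟩ (by simp only; omega) (by simp only; omega)
  have := hα ⟨kappa₂ α a - 1, by omega⟩
  omega

theorem tight_iff (x : Vertex d α) (k : Fin m) :
    Tight x k ↔ (k : ℕ) + 1 ≤ kappa₁ x.1 ∨ kappa₂ α x.1 ≤ k + 2 := by
  rw [succ_le_kappa₁_iff, kappa₂_le_iff, Tight]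

theorem getElem_oneLine (s : Equiv.Perm (Fin m)) (i : Fin m) :
    (oneLine s)[(i : ℕ)]'(by simp [oneLine]) = s i + 1 := by
  simp [oneLine]

theorem nodup_oneLine (s : Equiv.Perm (Fin m)) : (oneLine s).Nodup :=
  List.nodup_ofFn.2 fun i j h => s.injective (Fin.ext (by simpa using h))

theorem mem_oneLine (s : Equiv.Perm (Fin m)) {u : ℕ} : u ∈ oneLine s ↔ 1 ≤ u ∧ u ≤ m := by
  rw [oneLine, List.mem_ofFn]
  constructor
  · rintro ⟨i, rfl⟩
    exact ⟨by simp, (s i).2⟩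
  · rintro ⟨h1, h2⟩
    exact ⟨s.symm ⟨u - 1, by omega⟩, by simp; omega⟩

theorem mem_drop_of_oneLine_eq {s : Equiv.Perm (Fin m)} {l r : List ℕ} (h : oneLine s = l ++ r)
    {i j : Fin m} (hij : i ≤ j) (hi : (s i : ℕ) + 1 ∈ r) : (s j : ℕ) + 1 ∈ r := by
  have hnd := nodup_oneLine s
  rw [h] at hnd
  have hlen : ∀ i : Fin m, (i : ℕ) < (l ++ r).length := fun i => by
    rw [← h]
    simp [oneLine]
  have hget : ∀ i : Fin m, (l ++ r)[(i : ℕ)]'(hlen i) = s i + 1 := fun i => by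
    rw [← getElem_oneLine s i]
    simp only [h]
  have hil : l.length ≤ i := by
    by_contra hlt
    have h1 := hget i
    rw [List.getElem_append_left (by omega)] at h1
    exact (List.disjoint_of_nodup_append hnd) (h1 ▸ List.getElem_mem _) hi
  have h1 := hget j
  have := Fin.le_def.1 hij
  rw [List.getElem_append_right (by omega)] at h1
  exact h1 ▸ List.getElem_mem _

/-- The jumps at the tight places come last in a special signature. -/
theorem IsSpecialSignature.tight {x : Vertex d α} {s : Equiv.Perm (Fin m)}
    (hs : IsSpecialSignature α x.1 s) {i j : Fin m} (hij : i ≤ j) (hi : Tight x (s i)) :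
    Tight x (s j) := by
  have hm : 1 ≤ m := by have := i.2; omega
  rcases hs with ⟨hlt, l, hl⟩ | ⟨heq, -⟩
  · rw [List.append_assoc] at hl
    have h2 := kappa₂_le hm α x.1
    have hmem : ∀ k : Fin m, (k : ℕ) + 1 ∈
        (List.range' (kappa₂ α x.1 - 1) (m + 2 - kappa₂ α x.1)).reverse ++
          List.range' 1 (kappa₁ x.1) ↔ Tight x k := by
      intro k
      have := k.2
      rw [tight_iff, List.mem_append, List.mem_reverse, List.mem_range'_1, List.mem_range'_1]
      omega
    rw [← hmem] at hi ⊢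
    exact mem_drop_of_oneLine_eq hl hij hi
  -- When `κ₁ + 1 = κ₂`, every place is tight.
  · rw [tight_iff]
    omega

theorem exists_perm_oneLine {l : List ℕ} (hl : l.Perm (List.range' 1 m)) :
    ∃ s : Equiv.Perm (Fin m), oneLine s = l := by
  have hlen : l.length = m := by simpa using hl.length_eq
  have hmem : ∀ u ∈ l, 1 ≤ u ∧ u ≤ m := fun u hu => by
    have := List.mem_range'_1.1 (hl.mem_iff.1 hu)
    omega
  have hnd : l.Nodup := hl.nodup_iff.2 List.nodup_range'
  have hget : ∀ i : Fin m, 1 ≤ l[(i : ℕ)] ∧ l[(i : ℕ)] ≤ m := fun i => hmem _ (List.getElem_mem _)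
  let f : Fin m → Fin m := fun i => ⟨l[(i : ℕ)] - 1, by have := hget i; omega⟩
  have hf : Function.Injective f := fun i j h => by
    have h1 : l[(i : ℕ)] - 1 = l[(j : ℕ)] - 1 := congrArg Fin.val h
    have h2 := hget i
    have h3 := hget j
    exact Fin.ext ((hnd.getElem_inj_iff).1 (by omega : l[(i : ℕ)] = l[(j : ℕ)]))
  refine ⟨Equiv.ofBijective f (Finite.injective_iff_bijective.1 hf), ?_⟩
  refine List.ext_getElem (by simp [oneLine, hlen]) fun i h1 h2 => ?_
  have := hget ⟨i, by omega⟩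
  simp only at this
  simp [oneLine, f]
  omega

/-- The jump `u` must not be carried out before the jump `v` (numbered from `1`). -/
def Bad (x : Fin (m + 1) → ℕ) (α : Fin (m + 1) → ℕ) (u v : ℕ) : Prop :=
  ∃ k : Fin (m + 1), (u = k + 1 ∧ v = k ∧ x k = 0) ∨ (u = k ∧ v = k + 1 ∧ x k = α k)

theorem Fits.pairwise {x : Vertex d α} {s : Equiv.Perm (Fin m)} (h : Fits x s) :
    (oneLine s).Pairwise fun u v => ¬ Bad x.1 α u v := by
  rw [oneLine, List.pairwise_ofFn]
  rintro i j hij ⟨k, ⟨h1, h2, h3⟩ | ⟨h1, h2, h3⟩⟩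
  · have e1 := (pos_eq_iff s (k + 1) i).2 h1.symm
    have e2 := (pos_eq_iff s k j).2 h2.symm
    have := (h k).1 h3
    have := Fin.lt_def.1 hij
    omega
  · have e1 := (pos_eq_iff s k i).2 h1.symm
    have e2 := (pos_eq_iff s (k + 1) j).2 h2.symm
    have := (h k).2 h3
    have := Fin.lt_def.1 hij
    omega

theorem pos_lt (s : Equiv.Perm (Fin m)) {k : ℕ} (h1 : 1 ≤ k) (h2 : k ≤ m) : pos s k < m := by
  rw [pos, dif_pos ⟨h1, h2⟩]
  exact (s.symm _).2

/-- The conditions at the two end entries involve the nonexistent jumps `0` and `m + 1`, which `Bad`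
cannot detect in a word; the hypotheses on the first and last entry replace them. -/
theorem fits_of_pairwise {x : Vertex d α} {s : Equiv.Perm (Fin m)} (h0 : x.1 0 ≠ 0)
    (hlast : x.1 (Fin.last m) ≠ α (Fin.last m))
    (h : (oneLine s).Pairwise fun u v => ¬ Bad x.1 α u v) : Fits x s := by
  rw [oneLine, List.pairwise_ofFn] at h
  intro k
  have hk := k.2
  constructor
  · intro hx
    have hk0 : (k : ℕ) ≠ 0 := fun h => h0 ((Fin.ext h : k = 0) ▸ hx)
    by_contra hlt
    have l1 := pos_lt s (k := k) (by omega) (by omega)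
    have e1 := (pos_eq_iff s (k + 1) ⟨pos s (k + 1), by omega⟩).1 rfl
    have e2 := (pos_eq_iff s k ⟨pos s k, l1⟩).1 rfl
    exact h (Fin.lt_def.2 (not_le.1 hlt)) ⟨k, Or.inl ⟨e1.symm, e2.symm, hx⟩⟩
  · intro hx
    have hkm : (k : ℕ) ≠ m := fun h => hlast ((Fin.ext h : k = Fin.last m) ▸ hx)
    by_contra hlt
    have l1 := pos_lt s (k := k + 1) (by omega) (by omega)
    have e1 := (pos_eq_iff s (k + 1) ⟨pos s (k + 1), l1⟩).1 rfl
    have e2 := (pos_eq_iff s k ⟨pos s k, by omega⟩).1 rfl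
    exact h (Fin.lt_def.2 (not_le.1 hlt)) ⟨k, Or.inr ⟨e2.symm, e1.symm, hx⟩⟩

theorem Fits.zero_ne {x : Vertex d α} {s : Equiv.Perm (Fin m)} (hm : 1 ≤ m) (h : Fits x s) :
    x.1 0 ≠ 0 := fun h0 => by
  have h1 := (h 0).1 h0
  have h2 := pos_lt s (k := 1) le_rfl hm
  simp at h1
  omega

theorem Fits.last_ne {x : Vertex d α} {s : Equiv.Perm (Fin m)} (hm : 1 ≤ m) (h : Fits x s) :
    x.1 (Fin.last m) ≠ α (Fin.last m) := fun h0 => by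
  have h1 := (h (Fin.last m)).2 h0
  have h2 := pos_lt s (k := m) hm le_rfl
  simp at h1
  omega

/-- If `κ₁ + 1 < κ₂`, the non-tight jumps keep their order from `s`. The high block descends because
its entries are full, the low block ascends because its entries are empty. Moving the blocks to the
end breaks no condition: by the extremality of `κ₁` and `κ₂`, the entry bordering the low block is
not empty and the one bordering the high block is not full. -/
theorem exists_special (hm : 1 ≤ m) (hα : ∀ i, 1 ≤ α i) {x : Vertex d α}
    {s : Equiv.Perm (Fin m)} (h : Fits x s) :
    ∃ τ : Equiv.Perm (Fin m), Fits x τ ∧ IsSpecialSignature α x.1 τ := by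
  have b1 := kappa₁_le x.1
  have b2 := two_le_kappa₂ hm α x.1
  have b3 := kappa₂_le hm α x.1
  have b4 := kappa₁_lt_kappa₂ hm hα x.1
  have low : ∀ j : Fin (m + 1), 1 ≤ (j : ℕ) → (j : ℕ) + 1 ≤ kappa₁ x.1 → x.1 j = 0 :=
    fun j h1 h2 => ((succ_le_kappa₁_iff x.1 ⟨j, by omega⟩).1 h2).2 j h1 le_rfl
  have low_max : ∀ j : Fin (m + 1), 1 ≤ kappa₁ x.1 → kappa₁ x.1 = j → (j : ℕ) < m →
      x.1 j ≠ 0 := by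
    intro j h1 h2 h3 h4
    have h5 := (succ_le_kappa₁_iff x.1 ⟨j - 1, by omega⟩).1 (by simp only; omega)
    have h6 := (succ_le_kappa₁_iff x.1 ⟨j, h3⟩).2 ⟨h5.1, fun i h6 h7 => by
      rcases Nat.lt_or_ge i j with h8 | h8
      · exact h5.2 i h6 (by simp only; omega)
      · have : i = j := Fin.ext (le_antisymm h7 h8)
        rw [this, h4]⟩
    simp only at h6
    omega
  have high : ∀ j : Fin (m + 1), kappa₂ α x.1 ≤ (j : ℕ) + 1 → (j : ℕ) < m → x.1 j = α j :=
    fun j h1 h2 => ((kappa₂_le_iff α x.1 ⟨j - 1, by omega⟩).1 (by simp only; omega)).2 j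
      (by simp only; omega) h2
  have high_min : ∀ j : Fin (m + 1), 1 ≤ (j : ℕ) → (j : ℕ) < m → kappa₂ α x.1 = j + 2 →
      x.1 j ≠ α j := by
    intro j h1 h2 h3 h4
    have h5 := (kappa₂_le_iff α x.1 ⟨j, h2⟩).1 (by simp only; omega)
    have h6 := (kappa₂_le_iff α x.1 ⟨j - 1, by omega⟩).2 ⟨h5.1, fun i h6 h7 => by
      rcases Nat.lt_or_ge j i with h8 | h8
      · exact h5.2 i (by simp only; omega) h7
      · have : i = j := Fin.ext (by simp only at h6; omega)
        rw [this, h4]⟩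
    simp only at h6
    omega
  have hS : (List.range' 1 (kappa₁ x.1)).Pairwise fun u v => ¬ Bad x.1 α u v := by
    refine List.Pairwise.imp_of_mem ?_ (List.pairwise_lt_range' (s := 1) (n := kappa₁ x.1))
    rintro u v hu hv huv ⟨k, ⟨h1, h2, h3⟩ | ⟨h1, h2, h3⟩⟩
    · omega
    · rw [List.mem_range'_1] at hu hv
      have := low k (by omega) (by omega)
      have := hα k
      omega
  have hR : ∀ p n, kappa₂ α x.1 ≤ p + 1 → p + n ≤ m + 1 →
      (List.range' p n).reverse.Pairwise fun u v => ¬ Bad x.1 α u v := by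
    intro p n hp hn
    rw [List.pairwise_reverse]
    refine List.Pairwise.imp_of_mem ?_ (List.pairwise_lt_range' (s := p) (n := n))
    rintro v u hv hu huv ⟨k, ⟨h1, h2, h3⟩ | ⟨h1, h2, h3⟩⟩
    · rw [List.mem_range'_1] at hu hv
      have := high k (by omega) (by omega)
      have := hα k
      omega
    · omega
  rcases Nat.lt_or_ge (kappa₁ x.1 + 1) (kappa₂ α x.1) with hlt | hge
  · set F := (oneLine s).filter fun u => decide (kappa₁ x.1 < u ∧ u + 1 < kappa₂ α x.1) with hF
    have hFmem : ∀ u, u ∈ F ↔ (1 ≤ u ∧ u ≤ m) ∧ kappa₁ x.1 < u ∧ u + 1 < kappa₂ α x.1 := by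
      intro u
      rw [hF, List.mem_filter, mem_oneLine, decide_eq_true_iff]
    have hperm : (F ++ (List.range' (kappa₂ α x.1 - 1) (m + 2 - kappa₂ α x.1)).reverse ++
        List.range' 1 (kappa₁ x.1)).Perm (List.range' 1 m) := by
      rw [List.perm_ext_iff_of_nodup ?_ List.nodup_range']
      · intro u
        simp only [List.mem_append, List.mem_reverse, List.mem_range'_1, hFmem]
        omega
      · rw [List.nodup_append', List.nodup_append', List.nodup_reverse]
        refine ⟨⟨(nodup_oneLine s).filter _, List.nodup_range', ?_⟩, List.nodup_range', ?_⟩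
        · intro u hu hv
          rw [hFmem] at hu
          rw [List.mem_reverse, List.mem_range'_1] at hv
          omega
        · intro u hu hv
          rw [List.mem_append, List.mem_reverse, hFmem, List.mem_range'_1] at hu
          rw [List.mem_range'_1] at hv
          omega
    obtain ⟨τ, hτ⟩ := exists_perm_oneLine hperm
    refine ⟨τ, fits_of_pairwise (h.zero_ne hm) (h.last_ne hm) ?_, Or.inl ⟨hlt, F, hτ⟩⟩
    rw [hτ, List.pairwise_append, List.pairwise_append]
    refine ⟨⟨h.pairwise.filter _, hR _ _ (by omega) (by omega), ?_⟩, hS, ?_⟩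
    · rintro u hu v hv ⟨k, ⟨h1, h2, h3⟩ | ⟨h1, h2, h3⟩⟩ <;> rw [hFmem] at hu <;>
        rw [List.mem_reverse, List.mem_range'_1] at hv
      · omega
      · exact high_min k (by omega) (by omega) (by omega) h3
    · rintro u hu v hv ⟨k, ⟨h1, h2, h3⟩ | ⟨h1, h2, h3⟩⟩ <;>
        rw [List.mem_append, List.mem_reverse, hFmem, List.mem_range'_1] at hu <;>
        rw [List.mem_range'_1] at hv
      · exact low_max k (by omega) (by omega) (by omega) h3
      · omega
  · have heq : kappa₁ x.1 + 1 = kappa₂ α x.1 := by omega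
    have hperm : ((List.range' (kappa₂ α x.1) (m + 1 - kappa₂ α x.1)).reverse ++
        List.range' 1 (kappa₁ x.1)).Perm (List.range' 1 m) := by
      rw [List.perm_ext_iff_of_nodup ?_ List.nodup_range']
      · intro u
        simp only [List.mem_append, List.mem_reverse, List.mem_range'_1]
        omega
      · rw [List.nodup_append', List.nodup_reverse]
        refine ⟨List.nodup_range', List.nodup_range', ?_⟩
        intro u hu hv
        rw [List.mem_reverse, List.mem_range'_1] at hu
        rw [List.mem_range'_1] at hv
        omega
    obtain ⟨τ, hτ⟩ := exists_perm_oneLine hperm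
    refine ⟨τ, fits_of_pairwise (h.zero_ne hm) (h.last_ne hm) ?_, Or.inr ⟨heq, hτ⟩⟩
    rw [hτ, List.pairwise_append]
    refine ⟨hR _ _ (by omega) (by omega), hS, ?_⟩
    rintro u hu v hv ⟨k, ⟨h1, h2, h3⟩ | ⟨h1, h2, h3⟩⟩ <;>
      rw [List.mem_reverse, List.mem_range'_1] at hu <;> rw [List.mem_range'_1] at hv
    · have := high k (by omega) (by omega)
      have := hα k
      omega
    · omega

end Special

/-! ### The order on maximal cliques -/

section RuledOrders

variable {m d : ℕ} {α : Fin (m + 1) → ℕ}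

theorem exists_lexSmallest (hd : d < ∑ i, α i) : ∃ η : Vertex d α, IsLexSmallest η := by
  obtain ⟨l, -⟩ := exists_lowest hd
  obtain ⟨η, -, hη⟩ := exists_min_image univ (fun a : Vertex d α => toLex a.1) ⟨l, mem_univ l⟩
  exact ⟨η, fun a => hη a (mem_univ a)⟩

theorem exists_isMarking (hm : 1 ≤ m) (hα : ∀ i, 1 ≤ α i) (hd : d < ∑ i, α i) (hd0 : 0 < d) :
    ∃ L : MaxClique d α → MaxClique d α, IsMarking L := by
  choose a s ha hs using MaxClique.exists_chain (d := d) hα hd hd0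
  have hex : ∀ x : Vertex d α, (∃ s, Fits x s) → ∃ (C : MaxClique d α) (c : _)
      (τ : Equiv.Perm (Fin m)), IsTupleForm C c ∧ IsJumpChain τ c ∧ c 0 = x ∧
      IsSpecialSignature α x.1 τ := by
    rintro x ⟨s, hs⟩
    obtain ⟨τ, hτ, hsp⟩ := exists_special hm hα hs
    obtain ⟨c, hc0, hc⟩ := hτ.exists_chain hα
    obtain ⟨C, hC⟩ := hc.exists_maxClique
    exact ⟨C, c, τ, hC, hc, hc0, hsp⟩
  choose C c τ hC hc hc0 hsp using hex
  have hfit : ∀ A, ∃ s, Fits (a A 0) s := fun A => ⟨s A, (hs A).fits⟩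
  refine ⟨fun A => C (a A 0) (hfit A), fun A => ?_, fun A B h => ?_, fun A => ?_⟩
  · exact (equivalent_iff (ha A) (hC _ _)).2 (hc0 _ _).symm
  · have h := (equivalent_iff (ha A) (ha B)).1 h
    simp only [h]
  · exact ⟨a A, τ _ (hfit A), ha A, (hasSignature_iff (hC _ _) (hc _ _) _).2 rfl, hsp _ _⟩

theorem relSignature_injective (τ : Equiv.Perm (Fin m)) :
    Function.Injective (relSignature τ) := fun _ _ h =>
  Equiv.ext fun i => τ.symm.injective (congrFun h i)

theorem exists_isRuledOrder (hα : ∀ i, 1 ≤ α i) (hd : d < ∑ i, α i) (hd0 : 0 < d)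
    (η : Vertex d α) {L : MaxClique d α → MaxClique d α} (hL : IsMarking L) :
    ∃ prec, IsRuledOrder η L prec := by
  choose a s ha hs using MaxClique.exists_chain (d := d) hα hd hd0
  have hrank := fun A r => hasRank_iff (ha A) (hs A) η r
  have hsig := fun A t => hasSignature_iff (ha A) (hs A) t
  have heqv := fun A B => equivalent_iff (ha A) (ha B)
  -- The components serve the three rules: the height gives the rank, the first vertex separates the
  -- classes of equal rank, and the relative signature orders each class.
  let key : MaxClique d α → ℕ ×ₗ (Lex (Fin (m + 1) → ℕ) ×ₗ Lex (Fin m → Fin m)) := fun A =>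
    toLex (height (a A 0).1, toLex (toLex (a A 0).1, toLex (relSignature (s (L A)) (s A))))
  have hlt : ∀ A B, key A < key B ↔ height (a A 0).1 < height (a B 0).1 ∨
      height (a A 0).1 = height (a B 0).1 ∧ (toLex (a A 0).1 < toLex (a B 0).1 ∨
        (a A 0).1 = (a B 0).1 ∧
          toLex (relSignature (s (L A)) (s A)) < toLex (relSignature (s (L B)) (s B))) := by
    intro A B
    rw [Prod.Lex.lt_iff, Prod.Lex.lt_iff]
    rfl
  have hinj : Function.Injective key := by
    intro A B h
    have h1 := congrArg (fun z => (ofLex (ofLex z).2).1) h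
    have h2 := congrArg (fun z => (ofLex (ofLex z).2).2) h
    have h1 : a A 0 = a B 0 := Subtype.ext h1
    have hLL := hL.2.1 A B ((heqv A B).2 h1)
    have h2 : relSignature (s (L A)) (s A) = relSignature (s (L B)) (s B) := h2
    rw [hLL] at h2
    have h3 := relSignature_injective _ h2
    have h4 := hs A
    rw [h3] at h4
    have h5 := ha A
    rw [h4.unique (hs B) h1] at h5
    exact h5.eq (ha B)
  refine ⟨fun B A => key B < key A, ?_, ?_, ?_, ?_⟩
  · exact { irrefl := fun A => lt_irrefl _
            trans := fun A B C => lt_trans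
            trichotomous := fun A B h1 h2 => hinj (le_antisymm (not_lt.1 h2) (not_lt.1 h1)) }
  · intro A B rA rB hA hB h
    rw [hrank] at hA hB
    rw [hlt]
    left
    omega
  · intro A B r hA hB hAB hBA A' B' hA' hB'
    rw [hrank] at hA hB
    rw [heqv] at hAB hA' hB'
    rw [hlt, ← hA', ← hB']
    rcases (hlt B A).1 hBA with h | ⟨h, h' | ⟨h', -⟩⟩
    · exact Or.inl h
    · exact Or.inr ⟨h, Or.inl h'⟩
    · exact absurd (Subtype.ext h'.symm) hAB
  · intro A B kA kB τ hAB hA hB hτ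
    have hLL := hL.2.1 A B hAB
    rw [hsig] at hA hB hτ
    rw [heqv] at hAB
    rw [hlt, hA, hB, hτ, hAB, hLL]
    simp only [lt_irrefl, true_and, false_or]
    exact (or_iff_right fun h => (lt_irrefl _ h).elim)

/-- The shelling property of a ruled order. -/
theorem IsRuledOrder.exists_flip (hm : 2 ≤ m) (hα : ∀ i, 1 ≤ α i) (hd : d < ∑ i, α i)
    (hd0 : 0 < d) {η : Vertex d α} {L : MaxClique d α → MaxClique d α}
    {prec : MaxClique d α → MaxClique d α → Prop} (hL : IsMarking L)
    (hprec : IsRuledOrder η L prec) {A B : MaxClique d α} (hBA : prec B A) :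
    ∃ C, prec C A ∧ ∃ v ∈ A.1, v ∉ B.1 ∧ ∀ u ∈ A.1, u ≠ v → u ∈ C.1 := by
  have := hprec.isStrictTotalOrder
  obtain ⟨a, s, ha, hs⟩ := A.exists_chain hα hd hd0
  obtain ⟨b, t, hb, ht⟩ := B.exists_chain hα hd hd0
  obtain ⟨c, τ, hc, hτ⟩ := (L A).exists_chain hα hd hd0
  have hac : a 0 = c 0 := (equivalent_iff ha hc).1 (hL.1 A)
  have hLτ := (hasSignature_iff hc hτ τ).2 rfl
  have hAs := (hasSignature_iff ha hs s).2 rfl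
  have hfit : Fits (a 0) τ := hac ▸ hτ.fits
  have hspecial : IsSpecialSignature α (a 0).1 τ := by
    obtain ⟨a', τ', ha', hτ', hsp⟩ := hL.2.2 A
    rw [hasSignature_iff hc hτ] at hτ'
    rwa [hτ', ha'.unique ha] at hsp
  have hle : height (b 0).1 ≤ height (a 0).1 := by
    by_contra hlt
    have h1 := (hasRank_iff ha hs η _).2 rfl
    have h2 := (hasRank_iff hb ht η _).2 rfl
    have h3 := hprec.of_rank_lt _ _ _ _ h2 h1 (by omega)
    exact irrefl (r := prec) _ (trans_of prec h3 hBA)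
  have hswap : (∃ r, ∃ hr : r + 1 < m, τ.symm (s ⟨r + 1, hr⟩) < τ.symm (s ⟨r, by omega⟩) ∧
      ∀ j, b j ≠ a ⟨r + 1, by omega⟩) →
      ∃ C, prec C A ∧ ∃ v ∈ A.1, v ∉ B.1 ∧ ∀ u ∈ A.1, u ≠ v → u ∈ C.1 := by
    rintro ⟨r, hr, hdesc, hnot⟩
    obtain ⟨e, he, hea⟩ := hs.exists_swap hα hfit r hr hdesc
    obtain ⟨C, hC⟩ := he.exists_maxClique
    refine ⟨C, ?_, a ⟨r + 1, by omega⟩, ha.mem_iff.2 ⟨_, rfl⟩, ?_, ?_⟩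
    · refine (hprec.within_class A C s _ τ ?_ hAs ((hasSignature_iff hC he _).2 rfl) hLτ).2
        (relSignature_swapAt_lt r hr hdesc)
      exact (equivalent_iff ha hC).2 (hea 0 (by simp)).symm
    · rw [hb.mem_iff]
      rintro ⟨j, hj⟩
      exact hnot j hj
    · intro u hu hne
      obtain ⟨i, rfl⟩ := ha.mem_iff.1 hu
      exact hC.mem_iff.2 ⟨i, hea i fun h => hne (congrArg a (Fin.ext h))⟩
  by_cases h0 : b 0 = a 0
  · have hlt := (hprec.within_class A B s t τ ((equivalent_iff ha hb).2 h0.symm) hAs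
      ((hasSignature_iff hb ht t).2 rfl) hLτ).1 hBA
    exact hswap (exists_descent_of_relSignature_lt hs ht h0.symm hlt)
  · have hup : ∀ i j, i ≤ j → Tight (a 0) (τ i) → Tight (a 0) (τ j) :=
      fun i j hij hi => hspecial.tight hij hi
    obtain ⟨n, rfl⟩ : ∃ n, m = n + 1 := ⟨m - 1, by omega⟩
    by_cases htight : Tight (a 0) (s 0)
    · exact hswap (exists_descent_of_tight hs ht h0 hle hup 0 rfl htight)
    · obtain ⟨z, hz⟩ := hs.exists_isJump_last hm 0 rfl
        -- For the outermost jumps the range of entries in `Tight` is empty, so either obstruction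
        -- to repeating the jump already makes it tight.
        (fun h => htight (Or.inl ⟨h.2, fun j h1 h2 => by omega⟩))
        (fun h => htight (Or.inr ⟨h.2, fun j h1 h2 => by omega⟩))
      obtain ⟨s', e, he, hea⟩ := hs.exists_rotate hz
      obtain ⟨C, hC⟩ := he.exists_maxClique
      refine ⟨C, ?_, a 0, ha.mem_iff.2 ⟨_, rfl⟩, ?_, ?_⟩
      · have h1 := (hasRank_iff ha hs η _).2 rfl
        have h2 := (hasRank_iff hC he η _).2 rfl
        have h3 := hs.height_add (Fin.succ 0)
        rw [← hea 0, Fin.castSucc_zero] at h3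
        simp only [Fin.val_succ, Fin.val_zero] at h3
        exact hprec.of_rank_lt _ _ _ _ h1 h2 (by omega)
      · rw [hb.mem_iff]
        rintro ⟨j, hj⟩
        have h1 := ht.above (Fin.zero_le j)
        rw [hj] at h1
        exact h0 (h1.eq_of_height_le hle)
      · intro u hu hne
        obtain ⟨i, rfl⟩ := ha.mem_iff.1 hu
        rcases Fin.eq_zero_or_eq_succ i with rfl | ⟨j, rfl⟩
        · exact absurd rfl hne
        · exact hC.mem_iff.2 ⟨j.castSucc, hea j⟩

end RuledOrders

/-! ### Sorting and the fibres of the monomial map -/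

section Sorting

variable {m d : ℕ} {α : Fin (m + 1) → ℕ}

theorem exists_sorted (a b : Vertex d α) :
    ∃ a' b' : Vertex d α, sortPair a.1 b.1 = (a'.1, b'.1) := by
  have hbound : ∀ k : Fin (m + 1), pre a.1 (k + 1) + pre b.1 (k + 1) ≤
      pre a.1 k + pre b.1 k + 2 * α k := by
    intro k
    have := a.pre_succ_le k
    have := b.pre_succ_le k
    omega
  refine ⟨⟨(sortPair a.1 b.1).1, ?_, fun k => ?_⟩, ⟨(sortPair a.1 b.1).2, ?_, fun k => ?_⟩, rfl⟩
  · rw [← pre_of_le _ le_rfl, pre_sortPair_fst, a.pre_of_le le_rfl, b.pre_of_le le_rfl]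
    omega
  · have := hbound k
    rw [sortPair_fst_apply]
    omega
  · rw [← pre_of_le _ le_rfl, pre_sortPair_snd, a.pre_of_le le_rfl, b.pre_of_le le_rfl]
    omega
  · have := hbound k
    rw [sortPair_snd_apply]
    omega

theorem pre_of_sortPair_eq {a b a' b' : Fin (m + 1) → ℕ} (h : sortPair a b = (a', b')) (k : ℕ) :
    pre a' k = (pre a k + pre b k + 1) / 2 ∧ pre b' k = (pre a k + pre b k) / 2 := by
  rw [← pre_sortPair_fst, ← pre_sortPair_snd, h]
  exact ⟨rfl, rfl⟩

theorem add_eq_of_sortPair_eq {a b a' b' : Fin (m + 1) → ℕ} (h : sortPair a b = (a', b')) :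
    a' + b' = a + b := by
  refine eq_of_pre_eq fun k _ => ?_
  have := pre_of_sortPair_eq h k
  rw [pre_add, pre_add]
  omega

theorem above_of_sortPair_eq {a b a' b' : Fin (m + 1) → ℕ} (h : sortPair a b = (a', b')) :
    Above a' b' := fun k => by
  have := pre_of_sortPair_eq h k
  omega

theorem single_add_single_ne_of_sortPair_eq {a b a' b' : Vertex d α}
    (h : sortPair a.1 b.1 = (a'.1, b'.1)) (hab : ¬ (Above a.1 b.1 ∨ Above b.1 a.1)) :
    Finsupp.single a 1 + Finsupp.single b 1 ≠
      (Finsupp.single a' 1 + Finsupp.single b' 1 : Vertex d α →₀ ℕ) := by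
  classical
  intro heq
  have hs := above_of_sortPair_eq h
  have h1 := DFunLike.congr_fun heq a
  simp only [Finsupp.add_apply, Finsupp.single_apply, if_true] at h1
  by_cases h2 : a' = a
  · subst h2
    have := Finsupp.single_left_injective one_ne_zero (add_left_cancel heq)
    subst this
    exact hab (Or.inl hs)
  · by_cases h3 : b' = a
    · subst h3
      have := Finsupp.single_left_injective one_ne_zero
        (add_right_cancel ((add_comm _ _).trans heq))
      subst this
      exact hab (Or.inr hs)
    · rw [if_neg h2, if_neg h3] at h1
      omega

theorem above_or_above_of_sortPair_ne {a b a' b' : Vertex d α}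
    (h : sortPair a.1 b.1 = (a'.1, b'.1))
    (hne : Finsupp.single a 1 + Finsupp.single b 1 ≠
      (Finsupp.single a' 1 + Finsupp.single b' 1 : Vertex d α →₀ ℕ)) :
    ¬ (Above a.1 b.1 ∨ Above b.1 a.1) := by
  rintro (hab | hab)
  · have h1 := isSorted_iff_above.2 hab
    rw [IsSorted, h, Prod.mk.injEq] at h1
    exact hne (by rw [Subtype.ext h1.1, Subtype.ext h1.2])
  · have h1 : a' = b := Subtype.ext (eq_of_pre_eq fun k _ => by
      have := pre_of_sortPair_eq h k
      have := hab k
      omega)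
    have h2 : b' = a := Subtype.ext (eq_of_pre_eq fun k _ => by
      have := pre_of_sortPair_eq h k
      have := hab k
      omega)
    exact hne (by rw [h1, h2]; exact add_comm _ _)

/-! ### A sorting term order -/

/-- For a fixed total, the difference of the sums of squares is `2 (u - u') (u - v')`, and no
integer `u` lies strictly between the nearly equal `u'` and `v'`. -/
theorem sq_add_sq_le_of_balanced {u v u' v' : ℕ} (h : u + v = u' + v') (h1 : u' ≤ v' + 1)
    (h2 : v' ≤ u' + 1) : u' ^ 2 + v' ^ 2 ≤ u ^ 2 + v ^ 2 ∧
      (u + 2 ≤ v ∨ v + 2 ≤ u → u' ^ 2 + v' ^ 2 < u ^ 2 + v ^ 2) := by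
  zify at *
  have hv : (v : ℤ) = u' + v' - u := by linarith
  rw [hv]
  have key : (u : ℤ) ^ 2 + (u' + v' - u) ^ 2 - (u' ^ 2 + v' ^ 2) = 2 * ((u - u') * (u - v')) := by
    ring
  constructor
  · have : 0 ≤ ((u : ℤ) - u') * (u - v') := by
      rcases le_or_gt (u : ℤ) u' with h3 | h3 <;> rcases le_or_gt (u : ℤ) v' with h4 | h4
      · nlinarith
      · have : (u : ℤ) = u' := by omega
        simp [this]
      · have : (u : ℤ) = v' := by omega
        simp [this]
      · nlinarith
    linarith
  · intro h5
    have : 0 < ((u : ℤ) - u') * (u - v') := by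
      rcases h5 with h5 | h5
      · nlinarith [show (u : ℤ) < u' by omega, show (u : ℤ) < v' by omega]
      · nlinarith [show (u' : ℤ) < u by omega, show (v' : ℤ) < u by omega]
    linarith

/-- The sum of the squares of the sums of consecutive entries. -/
def sqWeight (a : Fin (m + 1) → ℕ) : ℕ :=
  ∑ p ∈ range (m + 1) ×ˢ range (m + 1), (pre a p.1 - pre a p.2) ^ 2

/-- Sorting balances the sums over every interval of entries, so no term grows. An incomparable pair
has an interval where its sums differ by at least two: a prefix, or the stretch between two prefixes
with differences `1` and `-1`. -/
theorem sqWeight_lt {a b a' b' : Fin (m + 1) → ℕ} (h : sortPair a b = (a', b'))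
    (hsum : ∑ i, a i = ∑ i, b i) (hab : ¬ (Above a b ∨ Above b a)) :
    sqWeight a' + sqWeight b' < sqWeight a + sqWeight b := by
  have hpre := pre_of_sortPair_eq h
  have hterm : ∀ k l, l ≤ k →
      (pre a k - pre a l) + (pre b k - pre b l) = (pre a' k - pre a' l) + (pre b' k - pre b' l) ∧
      pre a' k - pre a' l ≤ pre b' k - pre b' l + 1 ∧
      pre b' k - pre b' l ≤ pre a' k - pre a' l + 1 := by
    intro k l hlk
    have := hpre k
    have := hpre l
    have := pre_mono a hlk
    have := pre_mono b hlk
    omega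
  have hzero : ∀ (c : Fin (m + 1) → ℕ) {k l : ℕ}, k < l → pre c k - pre c l = 0 :=
    fun c k l hkl => Nat.sub_eq_zero_of_le (pre_mono c hkl.le)
  obtain ⟨k, l, hlk, hk, hstrict⟩ : ∃ k l, l ≤ k ∧ k < m + 1 ∧
      ((pre a k - pre a l) + 2 ≤ pre b k - pre b l ∨
        (pre b k - pre b l) + 2 ≤ pre a k - pre a l) := by
    rw [not_or] at hab
    obtain ⟨h1, h2⟩ := hab
    simp only [Above, not_forall] at h1 h2
    obtain ⟨k, hk⟩ := h1
    obtain ⟨l, hl⟩ := h2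
    have hout : ∀ k, m + 1 ≤ k → pre a k = pre b k := fun k hk => by
      rw [pre_of_le a hk, pre_of_le b hk, hsum]
    have hkm : k < m + 1 := by
      by_contra hn
      have := hout k (by omega)
      omega
    have hlm : l < m + 1 := by
      by_contra hn
      have := hout l (by omega)
      omega
    by_cases hk2 : pre a k + 2 ≤ pre b k ∨ pre b k + 2 ≤ pre a k
    · exact ⟨k, 0, Nat.zero_le _, hkm, by simpa using hk2⟩
    by_cases hl2 : pre a l + 2 ≤ pre b l ∨ pre b l + 2 ≤ pre a l
    · exact ⟨l, 0, Nat.zero_le _, hlm, by simpa using hl2⟩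
    rcases le_total l k with hlk | hkl
    · have := pre_mono a hlk
      have := pre_mono b hlk
      exact ⟨k, l, hlk, hkm, by omega⟩
    · have := pre_mono a hkl
      have := pre_mono b hkl
      exact ⟨l, k, hkl, hlm, by omega⟩
  rw [sqWeight, sqWeight, sqWeight, sqWeight, ← sum_add_distrib, ← sum_add_distrib]
  refine sum_lt_sum (fun p _ => ?_) ⟨(k, l), ?_, ?_⟩
  · rcases le_or_gt p.2 p.1 with hp | hp
    · obtain ⟨t1, t2, t3⟩ := hterm _ _ hp
      exact (sq_add_sq_le_of_balanced t1 t2 t3).1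
    · rw [hzero a' hp, hzero b' hp, hzero a hp, hzero b hp]
  · rw [mem_product, mem_range, mem_range]
    exact ⟨hk, by simp only; omega⟩
  · obtain ⟨t1, t2, t3⟩ := hterm _ _ hlk
    exact (sq_add_sq_le_of_balanced t1 t2 t3).2 hstrict

theorem exists_weightOrder {σ : Type} [Finite σ] (w : (σ →₀ ℕ) →+ ℕ) :
    ∃ ord : MonomialOrder.{0, 0} σ, ∀ a b, w a < w b → ord.toSyn a < ord.toSyn b := by
  let _ : LinearOrder σ := IsWellOrder.linearOrder (WellOrderingRel (α := σ))
  exact ⟨weightOrder w, fun a b => weightOrder_lt_of_weight_lt w⟩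

theorem exists_isSortingTermOrder :
    ∃ ord : MonomialOrder.{0, 0} (Vertex d α), IsSortingTermOrder ord := by
  obtain ⟨ord, hord⟩ := exists_weightOrder
    (Finsupp.liftAddHom fun c : Vertex d α => AddMonoidHom.mulRight (sqWeight c.1))
  refine ⟨ord, fun a b a' b' h hne => hord _ _ ?_⟩
  have := sqWeight_lt h (a.2.1.trans b.2.1.symm) (above_or_above_of_sortPair_ne h hne)
  simpa [map_add] using this

/-! ### Standard monomials -/

/-- The exponent of the image of `T^e` in `𝕂[x_1, …, x_n]`. -/
noncomputable def expo : (Vertex d α →₀ ℕ) →ₗ[ℕ] (Fin (m + 1) → ℕ) :=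
  Finsupp.linearCombination ℕ fun c => c.1

theorem expo_single (c : Vertex d α) (k : ℕ) : expo (Finsupp.single c k) = k • c.1 := by
  simp [expo]

theorem pre_smul (n : ℕ) (a : Fin (m + 1) → ℕ) (k : ℕ) : pre (n • a) k = n * pre a k := by
  simp [pre, mul_sum]

theorem pre_expo (e : Vertex d α →₀ ℕ) (k : ℕ) :
    pre (expo e) k = e.sum fun c n => n * pre c.1 k := by
  induction e using Finsupp.induction_linear with
  | zero => simp [pre]
  | add f g hf hg =>
    rw [map_add, pre_add, hf, hg, Finsupp.sum_add_index'] <;> intros <;> ring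
  | single c n => rw [expo_single, pre_smul, Finsupp.sum_single_index (by simp)]

theorem mul_degree_eq (e : Vertex d α →₀ ℕ) : pre (expo e) (m + 1) = e.degree * d := by
  rw [pre_expo, Finsupp.degree_apply, Finsupp.sum, sum_mul]
  exact sum_congr rfl fun c _ => by rw [c.pre_of_le le_rfl]

/-- All prefix sums in the support are those of the top vertex or one less. Hence those of the top
are the averages rounded up, and the top is determined by the image and the degree. -/
theorem exists_top_of_support {e : Vertex d α →₀ ℕ} (he : IsSortedFamily e.support) (h0 : e ≠ 0) :
    ∃ x ∈ e.support, ∀ k, pre (expo e) k ≤ e.degree * pre x.1 k ∧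
      e.degree * pre x.1 k < pre (expo e) k + e.degree := by
  obtain ⟨x, hx, htop⟩ := he.exists_top (Finsupp.support_nonempty_iff.2 h0)
  refine ⟨x, hx, fun k => ?_⟩
  rw [pre_expo, Finsupp.degree_apply, Finsupp.sum, sum_mul, ← sum_add_distrib]
  refine ⟨sum_le_sum fun c hc => Nat.mul_le_mul_left _ (htop c hc k).1,
    sum_lt_sum (fun c hc => ?_) ⟨x, hx, ?_⟩⟩
  · have := Nat.mul_le_mul_left (e c) (htop c hc k).2
    linarith
  · have := Finsupp.mem_support_iff.1 hx
    omega

/-- Monomials supported on cliques are determined by their image. -/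
theorem eq_of_expo_eq (hd0 : 0 < d) {e f : Vertex d α →₀ ℕ} (he : IsSortedFamily e.support)
    (hf : IsSortedFamily f.support) (h : expo e = expo f) : e = f := by
  induction hr : e.degree generalizing e f with
  | zero =>
    have h1 := mul_degree_eq e
    rw [h, mul_degree_eq, hr, zero_mul, mul_eq_zero, or_iff_left hd0.ne'] at h1
    rw [Finsupp.degree_eq_zero_iff] at h1 hr
    rw [h1, hr]
  | succ r ih =>
    have h1 := mul_degree_eq e
    rw [h, mul_degree_eq] at h1
    have h2 : f.degree = e.degree := Nat.eq_of_mul_eq_mul_right hd0 h1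
    have he0 : e ≠ 0 := fun h => by simp [h] at hr
    have hf0 : f ≠ 0 := fun h => by simp [h] at h2; omega
    obtain ⟨x, hx, hxk⟩ := exists_top_of_support he he0
    obtain ⟨y, hy, hyk⟩ := exists_top_of_support hf hf0
    have hxy : x = y := Subtype.ext (eq_of_pre_eq fun k _ => by
      have a1 := hxk k
      have a2 := hyk k
      rw [h2, ← h] at a2
      rcases lt_trichotomy (pre x.1 k) (pre y.1 k) with hlt | heq | hlt
      · nlinarith
      · exact heq
      · nlinarith)
    subst hxy
    have hsub : ∀ {g : Vertex d α →₀ ℕ}, x ∈ g.support →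
        ∃ g', g = Finsupp.single x 1 + g' := fun {g} hg =>
      exists_add_of_le (Finsupp.single_le_iff.2 (Nat.one_le_iff_ne_zero.2
        (Finsupp.mem_support_iff.1 hg)))
    obtain ⟨e', rfl⟩ := hsub hx
    obtain ⟨f', rfl⟩ := hsub hy
    have hmono : ∀ g : Vertex d α →₀ ℕ, IsSortedFamily (Finsupp.single x 1 + g).support →
        IsSortedFamily g.support := fun g hg a ha b hb => by
      have : ∀ c ∈ g.support, c ∈ (Finsupp.single x 1 + g).support := fun c hc => by
        rw [Finsupp.mem_support_iff] at hc ⊢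
        simp only [Finsupp.add_apply]
        omega
      exact hg a (this a ha) b (this b hb)
    rw [map_add, map_add] at h
    rw [ih (hmono _ he) (hmono _ hf) (add_left_cancel h) (by simp at hr; omega)]

/-- The monomials supported on cliques are the smallest ones in their fibres. -/
theorem IsSortingTermOrder.le_of_expo_eq {ord : MonomialOrder (Vertex d α)}
    (hord : IsSortingTermOrder ord) (hd0 : 0 < d) {e f : Vertex d α →₀ ℕ}
    (he : IsSortedFamily e.support) (h : expo e = expo f) : ord.toSyn e ≤ ord.toSyn f := by
  induction hf : ord.toSyn f using WellFoundedLT.induction generalizing f with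
  | ind y ih =>
    subst hf
    by_cases hs : IsSortedFamily f.support
    · rw [eq_of_expo_eq hd0 he hs h]
    · simp only [IsSortedFamily, not_forall] at hs
      obtain ⟨a, ha, b, hb, hab⟩ := hs
      have hne : a ≠ b := fun h => hab (by rw [h]; exact Or.inl (Above.refl _))
      obtain ⟨g, rfl⟩ : ∃ g, f = Finsupp.single a 1 + Finsupp.single b 1 + g := by
        refine exists_add_of_le fun c => ?_
        rw [Finsupp.mem_support_iff] at ha hb
        classical
        rw [Finsupp.add_apply, Finsupp.single_apply, Finsupp.single_apply]
        split_ifs with h1 h2 h2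
        · exact absurd (h1.trans h2.symm) hne
        · subst h1; omega
        · subst h2; omega
        · omega
      obtain ⟨a', b', hs⟩ := exists_sorted a b
      have hlt := hord a b a' b' hs (single_add_single_ne_of_sortPair_eq hs hab)
      have hlt' : ord.toSyn (Finsupp.single a' 1 + Finsupp.single b' 1 + g) <
          ord.toSyn (Finsupp.single a 1 + Finsupp.single b 1 + g) := by
        rw [map_add _ _ g, map_add _ _ g]
        exact add_lt_add_left hlt _
      refine (ih _ hlt' ?_ rfl).trans hlt'.le
      rw [h]
      simp only [map_add, expo_single, one_smul]
      rw [add_eq_of_sortPair_eq hs]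

end Sorting

/-! ### The initial ideal and its Alexander dual -/

section Ideals

theorem sqfreeExp_apply {σ : Type*} [DecidableEq σ] (F : Finset σ) (v : σ) :
    sqfreeExp F v = if v ∈ F then 1 else 0 := by
  rw [sqfreeExp, Finsupp.finsetSum_apply]
  simp only [Finsupp.single_apply, sum_ite_eq']

theorem support_sqfreeExp {σ : Type*} (F : Finset σ) : (sqfreeExp F).support = F := by
  classical
  ext v
  rw [Finsupp.mem_support_iff, sqfreeExp_apply]
  simp

theorem sqfreeExp_le_iff {σ : Type*} {F : Finset σ} {e : σ →₀ ℕ} :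
    sqfreeExp F ≤ e ↔ F ⊆ e.support := by
  classical
  constructor
  · intro h v hv
    have := h v
    rw [sqfreeExp_apply, if_pos hv] at this
    exact Finsupp.mem_support_iff.2 (by omega)
  · intro h v
    rw [sqfreeExp_apply]
    split_ifs with hv
    · exact Nat.one_le_iff_ne_zero.2 (Finsupp.mem_support_iff.1 (h hv))
    · exact Nat.zero_le _

theorem monomial_mem_span_iff {σ R : Type*} [CommRing R] [Nontrivial R] {S : Set (σ →₀ ℕ)}
    {e : σ →₀ ℕ} : MvPolynomial.monomial e (1 : R) ∈
      Ideal.span ((fun s => MvPolynomial.monomial s (1 : R)) '' S) ↔ ∃ s ∈ S, s ≤ e := by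
  classical
  rw [MvPolynomial.mem_ideal_span_monomial_image, MvPolynomial.support_monomial,
    if_neg one_ne_zero]
  simp

theorem monomial_mem_initialIdeal_iff {σ K : Type*} [Field K] (ord : MonomialOrder σ)
    (I : Ideal (MvPolynomial σ K)) {e : σ →₀ ℕ} :
    MvPolynomial.monomial e (1 : K) ∈ initialIdeal ord I ↔
      ∃ f ∈ I, f ≠ 0 ∧ ord.degree f ≤ e := by
  have h : initialIdeal ord I = Ideal.span ((fun s => MvPolynomial.monomial s (1 : K)) ''
      (ord.degree '' ((I : Set (MvPolynomial σ K)) \ {0}))) := by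
    rw [Set.image_image]
    exact ord.span_leadingTerm_eq_span_monomial'
  rw [h, monomial_mem_span_iff]
  constructor
  · rintro ⟨-, ⟨f, ⟨hf, hf0⟩, rfl⟩, hle⟩
    exact ⟨f, hf, hf0, hle⟩
  · rintro ⟨f, hf, hf0, hle⟩
    exact ⟨_, ⟨f, ⟨hf, hf0⟩, rfl⟩, hle⟩

theorem monomial_mem_alexanderDual_iff {σ K : Type*} [Field K] [Fintype σ] [DecidableEq σ]
    (I : Ideal (MvPolynomial σ K)) {e : σ →₀ ℕ} :
    MvPolynomial.monomial e (1 : K) ∈ alexanderDual I ↔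
      ∃ F ∈ stanleyReisnerComplex I, sqfreeExp Fᶜ ≤ e := by
  have h : alexanderDual I = Ideal.span ((fun s => MvPolynomial.monomial s (1 : K)) ''
      (sqfreeExp '' (dualComplex (stanleyReisnerComplex I))ᶜ)) := by
    rw [Set.image_image]
    rfl
  rw [h, monomial_mem_span_iff]
  constructor
  · rintro ⟨-, ⟨F, hF, rfl⟩, hle⟩
    exact ⟨Fᶜ, not_not.1 hF, by rwa [compl_compl]⟩
  · rintro ⟨F, hF, hle⟩
    refine ⟨_, ⟨Fᶜ, ?_, rfl⟩, hle⟩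
    change ¬ (Fᶜᶜ ∉ stanleyReisnerComplex I)
    rwa [compl_compl, not_not]

theorem mem_colon_monomial_iff {σ R : Type*} [CommRing R] {S : Set (σ →₀ ℕ)} {u : σ →₀ ℕ}
    {f : MvPolynomial σ R} :
    f ∈ (Ideal.span ((fun s => MvPolynomial.monomial s (1 : R)) '' S)).colon
        {MvPolynomial.monomial u (1 : R)} ↔ ∀ e ∈ f.support, ∃ s ∈ S, s ≤ e + u := by
  rw [Submodule.mem_colon_singleton, smul_eq_mul, MvPolynomial.mem_ideal_span_monomial_image]
  constructor
  · intro h e he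
    refine h (e + u) ?_
    rw [MvPolynomial.mem_support_iff] at he ⊢
    rwa [MvPolynomial.coeff_mul_monomial, mul_one]
  · intro h e he
    rw [MvPolynomial.mem_support_iff, MvPolynomial.coeff_mul_monomial'] at he
    split_ifs at he with hle
    · rw [mul_one] at he
      obtain ⟨s, hs, hs'⟩ := h _ (MvPolynomial.mem_support_iff.2 he)
      rw [tsub_add_cancel_of_le hle] at hs'
      exact ⟨s, hs, hs'⟩
    · exact absurd rfl he

variable {m d : ℕ} {α : Fin (m + 1) → ℕ} {K : Type*} [Field K]

theorem aeval_monomial_eq (e : Vertex d α →₀ ℕ) (r : K) :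
    MvPolynomial.aeval (R := K)
      (fun c : Vertex d α => ∏ i, (MvPolynomial.X i : MvPolynomial (Fin (m + 1)) K) ^ c.1 i)
      (MvPolynomial.monomial e r) =
    MvPolynomial.monomial (Finsupp.equivFunOnFinite.symm (expo e)) r := by
  have hvar : ∀ u : Fin (m + 1) → ℕ, ∏ i, (MvPolynomial.X i : MvPolynomial (Fin (m + 1)) K) ^ u i =
      MvPolynomial.monomial (Finsupp.equivFunOnFinite.symm u) 1 := by
    intro u
    rw [MvPolynomial.monomial_eq, Finsupp.prod_fintype _ _ (by simp)]
    simp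
  have hone : MvPolynomial.aeval (R := K)
      (fun c : Vertex d α => ∏ i, (MvPolynomial.X i : MvPolynomial (Fin (m + 1)) K) ^ c.1 i)
      (MvPolynomial.monomial e 1) =
      ∏ i, (MvPolynomial.X i : MvPolynomial (Fin (m + 1)) K) ^ expo e i := by
    induction e using Finsupp.induction_linear with
    | zero => simp
    | add f g hf hg =>
      rw [← mul_one (1 : K), ← MvPolynomial.monomial_mul, map_mul, hf, hg,
        ← prod_mul_distrib, map_add]
      exact prod_congr rfl fun i _ => (pow_add _ _ _).symm
    | single c k =>
      rw [← MvPolynomial.X_pow_eq_monomial, map_pow, MvPolynomial.aeval_X, expo_single,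
        ← prod_pow]
      refine prod_congr rfl fun i _ => ?_
      rw [← pow_mul, Pi.smul_apply, smul_eq_mul, mul_comm]
  rw [show MvPolynomial.monomial e r = r • MvPolynomial.monomial e (1 : K) by
    rw [MvPolynomial.smul_monomial, smul_eq_mul, mul_one], map_smul, hone, hvar,
    MvPolynomial.smul_monomial, smul_eq_mul, mul_one]

/-- The sum over a fibre is the coefficient of `x^u` in the image of `f`. -/
theorem sum_coeff_eq_zero {f : MvPolynomial (Vertex d α) K}
    (hf : f ∈ presentationIdeal K d α) (u : Fin (m + 1) → ℕ) :
    ∑ e ∈ f.support with expo e = u, f.coeff e = 0 := by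
  have h : MvPolynomial.aeval (R := K)
      (fun c : Vertex d α => ∏ i, (MvPolynomial.X i : MvPolynomial (Fin (m + 1)) K) ^ c.1 i) f =
        0 := hf
  rw [f.as_sum, map_sum] at h
  simp only [aeval_monomial_eq] at h
  have h1 := congrArg (MvPolynomial.coeff (Finsupp.equivFunOnFinite.symm u)) h
  rw [MvPolynomial.coeff_sum, MvPolynomial.coeff_zero] at h1
  rw [sum_filter]
  refine Eq.trans ?_ h1
  refine sum_congr rfl fun e _ => ?_
  rw [MvPolynomial.coeff_monomial]
  simp only [EmbeddingLike.apply_eq_iff_eq]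

theorem binomial_mem_presentationIdeal {e f : Vertex d α →₀ ℕ} (h : expo e = expo f) :
    MvPolynomial.monomial e (1 : K) - MvPolynomial.monomial f 1 ∈ presentationIdeal K d α := by
  rw [presentationIdeal, RingHom.mem_ker]
  change MvPolynomial.aeval _ _ = 0
  rw [map_sub, aeval_monomial_eq, aeval_monomial_eq, h, sub_self]

/-- The squarefree monomials outside the initial ideal are those supported on cliques. -/
theorem stanleyReisnerComplex_initialIdeal (hd0 : 0 < d) {ord : MonomialOrder (Vertex d α)}
    (hord : IsSortingTermOrder ord) :
    stanleyReisnerComplex (initialIdeal ord (presentationIdeal K d α)) =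
      {F | IsSortedFamily F} := by
  classical
  ext F
  rw [stanleyReisnerComplex, Set.mem_ofPred_eq, Set.mem_ofPred_eq, monomial_mem_initialIdeal_iff]
  constructor
  · intro h
    by_contra hF
    simp only [IsSortedFamily, not_forall] at hF
    obtain ⟨a, ha, b, hb, hab⟩ := hF
    obtain ⟨a', b', hs⟩ := exists_sorted a b
    have hlt := hord a b a' b' hs (single_add_single_ne_of_sortPair_eq hs hab)
    refine h ⟨_, binomial_mem_presentationIdeal (K := K)
      (e := Finsupp.single a 1 + Finsupp.single b 1)
      (f := Finsupp.single a' 1 + Finsupp.single b' 1) ?_, ?_, ?_⟩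
    · simp only [map_add, expo_single, one_smul]
      rw [add_eq_of_sortPair_eq hs]
    · rw [sub_ne_zero]
      intro heq
      have := (MvPolynomial.monomial_left_injective (one_ne_zero (α := K))) heq
      rw [this] at hlt
      exact lt_irrefl _ hlt
    · rw [MonomialOrder.degree_sub_of_lt]
      · rw [MonomialOrder.degree_monomial, if_neg one_ne_zero]
        have hne : a ≠ b := fun h => hab (by rw [h]; exact Or.inl (Above.refl _))
        intro c
        rw [sqfreeExp_apply, Finsupp.add_apply, Finsupp.single_apply, Finsupp.single_apply]
        split_ifs with h1 h2 h3 h3 h4 h5 h6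
        all_goals first | omega | skip
        · exact absurd (h1.trans h2.symm) hne
        all_goals subst_vars; contradiction
      · rw [MonomialOrder.degree_monomial, MonomialOrder.degree_monomial, if_neg one_ne_zero,
          if_neg one_ne_zero]
        exact hlt
  · rintro hF ⟨f, hf, hf0, hle⟩
    have hsupp : IsSortedFamily (ord.degree f).support := by
      have : (ord.degree f).support ⊆ F := by
        rw [← support_sqfreeExp F]
        exact Finsupp.support_mono hle
      exact fun a ha b hb => hF a (this ha) b (this hb)
    have hsum := sum_coeff_eq_zero hf (expo (ord.degree f))
    have hmem : ord.degree f ∈ f.support.filter fun e => expo e = expo (ord.degree f) :=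
      mem_filter.2 ⟨ord.degree_mem_support hf0, rfl⟩
    -- A leading monomial supported on a clique is both the largest monomial of `f` and the smallest
    -- of its fibre. It is thus alone in its fibre, and its coefficient would vanish.
    rw [sum_eq_single_of_mem _ hmem] at hsum
    · exact ord.leadingCoeff_ne_zero_iff.2 hf0 hsum
    · intro e he hne
      rw [mem_filter] at he
      have h1 := hord.le_of_expo_eq hd0 hsupp he.2.symm
      exact absurd (ord.toSyn.injective (le_antisymm (ord.le_degree he.1) h1)) hne

theorem IsSortedFamily.exists_maxClique {C : Finset (Vertex d α)} (hC : IsSortedFamily C) :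
    ∃ A : MaxClique d α, C ⊆ A.1 := by
  obtain ⟨A, hCA, hA⟩ := Set.Finite.exists_le_maximal (Set.toFinite
    {C : Finset (Vertex d α) | (sortingGraph d α).IsClique (C : Set (Vertex d α))})
    (isClique_iff.2 hC)
  exact ⟨⟨A, hA⟩, hCA⟩

theorem MaxClique.eq_of_subset {A B : MaxClique d α} (h : A.1 ⊆ B.1) : A = B :=
  Subtype.ext (A.2.eq_of_le B.2.prop h)

theorem complExp_injective : Function.Injective (complExp : MaxClique d α → (Vertex d α →₀ ℕ)) := by
  intro A B h
  have := congrArg Finsupp.support h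
  rw [complExp, complExp, support_sqfreeExp, support_sqfreeExp] at this
  exact Subtype.ext (compl_injective this)

variable {I : Ideal (MvPolynomial (Vertex d α) K)}

/-- The dual is generated by the complements of faces. Enlarging a face to a maximal clique gives a
divisor, and no maximal clique contains another, so the complements of maximal cliques are the
minimal generators. -/
theorem range_complExp (hI : stanleyReisnerComplex I = {F | IsSortedFamily F}) :
    Set.range (complExp : MaxClique d α → (Vertex d α →₀ ℕ)) = minGens (alexanderDual I) := by
  have hmem : ∀ e : Vertex d α →₀ ℕ, MvPolynomial.monomial e (1 : K) ∈ alexanderDual I ↔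
      ∃ A : MaxClique d α, complExp A ≤ e := by
    intro e
    rw [monomial_mem_alexanderDual_iff, hI]
    constructor
    · rintro ⟨F, hF, hle⟩
      obtain ⟨A, hA⟩ := IsSortedFamily.exists_maxClique hF
      refine ⟨A, sqfreeExp_le_iff.2 ?_⟩
      exact (compl_subset_compl.2 hA).trans (sqfreeExp_le_iff.1 hle)
    · rintro ⟨A, hA⟩
      exact ⟨A.1, A.isSortedFamily, hA⟩
  ext u
  simp only [minGens, hmem, Set.mem_range, Set.mem_ofPred_eq]
  constructor
  · rintro ⟨A, rfl⟩
    refine ⟨⟨A, le_rfl⟩, fun e ⟨B, hB⟩ hle => ?_⟩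
    have h := sqfreeExp_le_iff.1 (hB.trans hle)
    rw [complExp, support_sqfreeExp, compl_subset_compl] at h
    rwa [MaxClique.eq_of_subset h]
  · rintro ⟨⟨A, hA⟩, hmin⟩
    exact ⟨A, le_antisymm hA (hmin ⟨A, le_rfl⟩ hA)⟩

/-- A shelling of the maximal cliques gives linear quotients for the dual ideal. -/
theorem isLinearQuotientOrder_of_shelling (hI : stanleyReisnerComplex I = {F | IsSortedFamily F})
    {prec : MaxClique d α → MaxClique d α → Prop} (hprec : IsStrictTotalOrder _ prec)
    (hshell : ∀ A B, prec B A → ∃ C, prec C A ∧ ∃ v ∈ A.1, v ∉ B.1 ∧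
      ∀ u ∈ A.1, u ≠ v → u ∈ C.1) :
    IsLinearQuotientOrder (alexanderDual I) (inducedRel prec) := by
  classical
  have hrel : ∀ B A, inducedRel prec (complExp B) (complExp A) ↔ prec B A := by
    intro B A
    constructor
    · rintro ⟨B', A', hB, hA, h⟩
      rwa [complExp_injective hB, complExp_injective hA] at h
    · exact fun h => ⟨B, A, rfl, rfl, h⟩
  have hrange := range_complExp hI
  constructor
  · have hex : ∀ u : minGens (alexanderDual I), ∃ A : MaxClique d α, complExp A = u.1 := fun u => by
      have h := hrange.ge u.2
      exact h
    exact
      { irrefl := fun u h => by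
          obtain ⟨A, hA⟩ := hex u
          rw [← hA, hrel] at h
          exact irrefl A h
        trans := fun u v w h1 h2 => by
          obtain ⟨A, hA⟩ := hex u
          obtain ⟨B, hB⟩ := hex v
          obtain ⟨C, hC⟩ := hex w
          rw [← hA, ← hB, hrel] at h1
          rw [← hB, ← hC, hrel] at h2
          rw [← hA, ← hC, hrel]
          exact _root_.trans h1 h2
        trichotomous := fun u v h1 h2 => by
          obtain ⟨A, hA⟩ := hex u
          obtain ⟨B, hB⟩ := hex v
          rw [← hA, ← hB, hrel] at h1
          rw [← hA, ← hB, hrel] at h2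
          have hAB : A = B := by
            rcases trichotomous_of prec A B with h | h | h
            · exact absurd h h1
            · exact h
            · exact absurd h h2
          exact Subtype.ext (by rw [← hA, ← hB, hAB]) }
  · intro u hu
    rw [← hrange] at hu
    obtain ⟨A, rfl⟩ := hu
    -- The variables are the vertices that an earlier clique can replace: `T_{C^∁}` divides `T_v
    -- T_{A^∁}` exactly when `A \ {v} ⊆ C`. Conversely, if `T_{B^∁}` divides `T^e T_{A^∁}` and `v ∈
    -- A \ B`, then `T_v` must divide `T^e`.
    refine ⟨{v | v ∈ A.1 ∧ ∃ C, prec C A ∧ ∀ w ∈ A.1, w ≠ v → w ∈ C.1}, ?_⟩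
    ext f
    rw [mem_colon_monomial_iff, MvPolynomial.mem_ideal_span_X_image]
    refine forall₂_congr fun e _ => ?_
    constructor
    · rintro ⟨s, ⟨hs, hsA⟩, hle⟩
      rw [← hrange] at hs
      obtain ⟨B, rfl⟩ := hs
      rw [hrel] at hsA
      obtain ⟨C, hCA, v, hvA, hvB, hC⟩ := hshell A B hsA
      refine ⟨v, ⟨hvA, C, hCA, hC⟩, fun hv => ?_⟩
      have := hle v
      rw [Finsupp.add_apply, hv, complExp, complExp, sqfreeExp_apply, sqfreeExp_apply,
        if_pos (mem_compl.2 hvB), if_neg (by rwa [mem_compl, not_not])] at this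
      omega
    · rintro ⟨v, ⟨hvA, C, hCA, hC⟩, hv⟩
      refine ⟨complExp C, ⟨hrange ▸ ⟨C, rfl⟩, (hrel C A).2 hCA⟩, fun w => ?_⟩
      rw [Finsupp.add_apply, complExp, complExp, sqfreeExp_apply, sqfreeExp_apply]
      by_cases hw : w = v
      · subst hw
        split_ifs <;> omega
      · by_cases hwA : w ∈ A.1
        · rw [if_neg (by rw [mem_compl, not_not]; exact hC w hwA hw)]
          omega
        · rw [if_pos (mem_compl.2 hwA)]
          split_ifs <;> omega

end Ideals

end VeroneseSorting

theorem theorem4p14 (K : Type u) [Field K] (m d : ℕ) (α : Fin (m + 1) → ℕ)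
    (hm : 3 ≤ m + 1) (hα_mono : Monotone α) (hα_pos : ∀ i, 1 ≤ α i) (hα_le : ∀ i, α i ≤ d)
    (hd : d < ∑ i, α i) :
    -- the objects in question exist
    (∃ ord : MonomialOrder.{0, 0} (Vertex d α), IsSortingTermOrder ord) ∧
    (∃ η : Vertex d α, IsLexSmallest η) ∧
    (∃ L : MaxClique d α → MaxClique d α, IsMarking L) ∧
    (∀ (η : Vertex d α) (L : MaxClique d α → MaxClique d α), IsLexSmallest η → IsMarking L →
      ∃ prec : MaxClique d α → MaxClique d α → Prop, IsRuledOrder η L prec) ∧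
    ∀ ord : MonomialOrder.{0, w} (Vertex d α), IsSortingTermOrder ord →
      -- the minimal generators correspond to the complements of the maximal cliques
      (Function.Injective (complExp : MaxClique d α → (Vertex d α →₀ ℕ)) ∧
        Set.range (complExp : MaxClique d α → (Vertex d α →₀ ℕ)) =
          minGens (alexanderDual (initialIdeal ord (presentationIdeal K d α)))) ∧
      -- the order gives linear quotients
      ∀ (η : Vertex d α) (L : MaxClique d α → MaxClique d α)
        (prec : MaxClique d α → MaxClique d α → Prop),
        IsLexSmallest η → IsMarking L → IsRuledOrder η L prec →
        IsLinearQuotientOrder (alexanderDual (initialIdeal ord (presentationIdeal K d α)))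
          (inducedRel prec) := by
  have hd0 : 0 < d := (hα_pos 0).trans (hα_le 0)
  refine ⟨exists_isSortingTermOrder, exists_lexSmallest hd,
    exists_isMarking (by omega) hα_pos hd hd0,
    fun η L _ hL => exists_isRuledOrder hα_pos hd hd0 η hL, fun ord hord => ?_⟩
  have hI := stanleyReisnerComplex_initialIdeal (K := K) hd0 hord
  refine ⟨⟨complExp_injective, range_complExp hI⟩, fun η L prec _ hL hprec => ?_⟩
  exact isLinearQuotientOrder_of_shelling hI hprec.isStrictTotalOrder fun A B hBA =>
    hprec.exists_flip (by omega) hα_pos hd hd0 hL hBA
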